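/- All graphs are finite and simple. A colored graph is a graph $X$ with a map $c\colon V(X)\to C$ to a set of colors (adjacent vertices may have the same color). Let $C(\mathrm{Qut}_c(X))$ be the universal unital $C^*$-algebra generated by elements $u_{ij}$ ($i,j\in V(X)$) subject to $$u_{ij}=u_{ij}^*=u_{ij}^2,\qquad \sum_k u_{ik}=1=\sum_k u_{kj},\qquad u_{ij}u_{kl}=0\ \text{ if } ik\in E(X),\ jl\notin E(X)\text{ or vice versa},\qquad u_{ij}=0\ \text{ if } c(i)\neq c(j).$$ The quantum automorphism group $\mathrm{Qut}_c(X)$ is the compact matrix quantum group given by this algebra, the fundamental representation $u=(u_{ij})$ and the comultiplication $\Delta(u_{ij})=\sum_k u_{ik}\otimes u_{kj}$ (with values in the minimal tensor product). Two compact quantum groups $\mathbb G,\mathbb H$ are isomorphic, $\mathbb G\cong\mathbb H$, if there is a $*$-isomorphism $\varphi\colon C(\mathbb G)\to C(\mathbb H)$ with $(\varphi\otimes\varphi)\circ\Delta_{\mathbb G}=\Delta_{\mathbb H}\circ\varphi$. The quantum orbits of $X$ are the classes of the equivalence relation $i\sim j\iff u_{ij}\neq 0$ on $V(X)$. **Lemma.**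 Let $X$ be a colored graph. 1. Let $S\subseteq V(X)$ be an independent set which is a union of color classes, and let $Y$ be obtained from $X$ by adding an edge between every pair of distinct vertices of $S$. Then $\mathrm{Qut}_c(X)\cong\mathrm{Qut}_c(Y)$. 2. Let $S,T\subseteq V(X)$ be disjoint sets, each a union of color classes, such that $S\cup T$ is an independent set, and let $Y$ be obtained from $X$ by adding an edge from every $s\in S$ to every $t\in T$. Then $\mathrm{Qut}_c(X)\cong\mathrm{Qut}_c(Y)$. 3. Let $S\subseteq V(X)$ be a monochromatic set which is a union of quantum orbits of $X$, and let $Y$ be obtained from $X$ by changing the color of all vertices of $S$ to a new color (one that does not occur outside $S$; the set of colors may be enlarged for this). Then $\mathrm{Qut}_c(X)\cong\mathrm{Qut}_c(Y)$. 4. Let $Y$ be obtained from $X$ by adding an isolated vertex in a new color (one that does not occur in $X$; the set of colors may be enlarged for this). Then $\mathrm{Qut}_c(X)\cong\mathrm{Qut}_c(Y)$. -/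

import Mathlib

open scoped TensorProduct ComplexOrder

noncomputable section

universe u v w

/-- A `C*`-seminorm on a unital complex `*`-algebra. -/
structure CStarSeminorm (D : Type u) [Ring D] [StarRing D] [Algebra ℂ D] extends
    Seminorm ℂ D where
  mul_le' : ∀ x y : D, toFun (x * y) ≤ toFun x * toFun y
  star_mul_self' : ∀ x : D, toFun (star x * x) = toFun x * toFun x

namespace CStarSeminorm

section basic

variable {D : Type u} [Ring D] [StarRing D] [Algebra ℂ D]

instance : CoeFun (CStarSeminorm D) (fun _ => D → ℝ) := ⟨fun p => p.toSeminorm⟩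

variable (p : CStarSeminorm D)

theorem nonneg (x : D) : 0 ≤ p x := apply_nonneg p.toSeminorm x

theorem mul_le (x y : D) : p (x * y) ≤ p x * p y := p.mul_le' x y

theorem star_mul_self (x : D) : p (star x * x) = p x * p x := p.star_mul_self' x

theorem le_star (x : D) : p x ≤ p (star x) := by
  have h := p.mul_le (star x) x
  rw [p.star_mul_self] at h
  rcases (p.nonneg x).eq_or_lt with h0 | h0
  · rw [← h0]; exact p.nonneg _
  · exact le_of_mul_le_mul_right h h0

theorem map_star (x : D) : p (star x) = p x :=
  le_antisymm (by simpa using p.le_star (star x)) (p.le_star x)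

/-- The pointwise supremum of a pointwise bounded set of `C*`-seminorms. -/
def sup (S : Set (CStarSeminorm D))
    (hS : ∀ x : D, BddAbove (Set.range fun p : S => (p : CStarSeminorm D) x)) :
    CStarSeminorm D where
  toFun x := ⨆ p : S, (p : CStarSeminorm D) x
  map_zero' := by simp
  add_le' x y := by
    have h0 (z : D) : 0 ≤ ⨆ p : S, (p : CStarSeminorm D) z :=
      Real.iSup_nonneg fun p => p.1.nonneg z
    refine Real.iSup_le (fun p => ?_) (add_nonneg (h0 x) (h0 y))
    exact (map_add_le_add p.1.toSeminorm x y).trans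
      (add_le_add (le_ciSup (hS x) p) (le_ciSup (hS y) p))
  neg' x := by simp
  smul' a x := by
    simp only [map_smul_eq_mul]
    rw [Real.mul_iSup_of_nonneg (norm_nonneg a)]
  mul_le' x y := by
    have h0 (z : D) : 0 ≤ ⨆ p : S, (p : CStarSeminorm D) z :=
      Real.iSup_nonneg fun p => p.1.nonneg z
    refine Real.iSup_le (fun p => ?_) (mul_nonneg (h0 x) (h0 y))
    exact (p.1.mul_le x y).trans
      (mul_le_mul (le_ciSup (hS x) p) (le_ciSup (hS y) p) (p.1.nonneg y) (h0 x))
  star_mul_self' x := by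
    have h0 (z : D) : 0 ≤ ⨆ p : S, (p : CStarSeminorm D) z :=
      Real.iSup_nonneg fun p => p.1.nonneg z
    refine le_antisymm (Real.iSup_le (fun p => ?_) (mul_nonneg (h0 x) (h0 x))) ?_
    · rw [p.1.star_mul_self]
      exact mul_le_mul (le_ciSup (hS x) p) (le_ciSup (hS x) p) (p.1.nonneg x) (h0 x)
    · rw [Real.mul_iSup_of_nonneg (h0 x)]
      refine Real.iSup_le (fun p => ?_) (h0 _)
      rw [Real.iSup_mul_of_nonneg (p.1.nonneg x)]
      refine Real.iSup_le (fun q => ?_) (h0 _)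
      rcases le_total (p.1 x) (q.1 x) with h | h
      · refine le_trans (mul_le_mul_of_nonneg_left h (q.1.nonneg x)) ?_
        rw [← q.1.star_mul_self]
        exact le_ciSup (hS (star x * x)) q
      · refine le_trans (mul_le_mul_of_nonneg_right h (p.1.nonneg x)) ?_
        rw [← p.1.star_mul_self]
        exact le_ciSup (hS (star x * x)) p

theorem le_sup {S : Set (CStarSeminorm D)}
    (hS : ∀ x : D, BddAbove (Set.range fun p : S => (p : CStarSeminorm D) x))
    {p : CStarSeminorm D} (hp : p ∈ S) (x : D) : p x ≤ sup S hS x :=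
  le_ciSup (hS x) ⟨p, hp⟩

theorem sup_le {S : Set (CStarSeminorm D)}
    (hS : ∀ x : D, BddAbove (Set.range fun p : S => (p : CStarSeminorm D) x))
    {x : D} {r : ℝ} (hr : 0 ≤ r) (h : ∀ p ∈ S, p x ≤ r) : sup S hS x ≤ r :=
  Real.iSup_le (fun p => h p.1 p.2) hr

/-- The `C*`-seminorm `x ↦ ‖φ x‖` defined by a `*`-homomorphism into a `C*`-algebra. -/
def ofStarAlgHom {B : Type v} [CStarAlgebra B] (φ : D →⋆ₐ[ℂ] B) : CStarSeminorm D where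
  toFun x := ‖φ x‖
  map_zero' := by simp
  add_le' x y := by simpa using norm_add_le (φ x) (φ y)
  neg' x := by simp
  smul' a x := by simp [norm_smul]
  mul_le' x y := by simpa using norm_mul_le (φ x) (φ y)
  star_mul_self' x := by
    rw [map_mul, StarHomClass.map_star φ x]
    exact CStarRing.norm_star_mul_self (x := φ x)

@[simp] theorem ofStarAlgHom_apply {B : Type v} [CStarAlgebra B] (φ : D →⋆ₐ[ℂ] B) (x : D) :
    ofStarAlgHom φ x = ‖φ x‖ := rfl

/-- A copy of the `*`-algebra `D`, carrying the topology of the seminorm `p`. -/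
@[nolint unusedArguments]
def Pre (_p : CStarSeminorm D) : Type u := D

instance : Ring p.Pre := inferInstanceAs (Ring D)
instance : StarRing p.Pre := inferInstanceAs (StarRing D)
instance : Algebra ℂ p.Pre := inferInstanceAs (Algebra ℂ D)
instance [StarModule ℂ D] : StarModule ℂ p.Pre := inferInstanceAs (StarModule ℂ D)

instance : SeminormedRing p.Pre where
  __ := (inferInstance : Ring p.Pre)
  __ := p.toSeminorm.toAddGroupSeminorm.toSeminormedAddCommGroup
  norm_mul_le := p.mul_le

theorem norm_pre (x : p.Pre) : ‖x‖ = p x := rfl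

instance : NormedAlgebra ℂ p.Pre where
  norm_smul_le a x := (map_smul_eq_mul p.toSeminorm a x).le

instance : NormedStarGroup p.Pre where
  norm_star_le x := (p.map_star x).le

/-- The Hausdorff completion, as a normed algebra. -/
abbrev PreCompl (p : CStarSeminorm D) : Type u := UniformSpace.Completion p.Pre

open UniformSpace

theorem continuous_star_pre : UniformContinuous (star : p.Pre → p.Pre) :=
  star_isometry.uniformContinuous

instance : Star p.PreCompl := ⟨Completion.map star⟩

theorem coe_star (x : p.Pre) : ((star x : p.Pre) : p.PreCompl) = star (x : p.PreCompl) :=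
  (Completion.map_coe p.continuous_star_pre x).symm

instance : ContinuousStar p.PreCompl := ⟨Completion.continuous_map⟩

instance : StarRing p.PreCompl where
  star_involutive x := by
    induction x using Completion.induction_on with
    | hp => exact isClosed_eq (by fun_prop) (by fun_prop)
    | ih x => rw [← coe_star, ← coe_star, star_star]
  star_mul x y := by
    induction x, y using Completion.induction_on₂ with
    | hp => exact isClosed_eq (by fun_prop) (by fun_prop)
    | ih x y => rw [← Completion.coe_mul, ← coe_star, ← coe_star, ← coe_star, star_mul,
        Completion.coe_mul]
  star_add x y := by
    induction x, y using Completion.induction_on₂ with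
    | hp => exact isClosed_eq (by fun_prop) (by fun_prop)
    | ih x y => rw [← Completion.coe_add, ← coe_star, ← coe_star, ← coe_star, star_add,
        Completion.coe_add]

instance : CStarRing p.PreCompl where
  norm_mul_self_le x := by
    induction x using Completion.induction_on with
    | hp => exact isClosed_le (by fun_prop) (by fun_prop)
    | ih x =>
      rw [← coe_star, ← Completion.coe_mul, Completion.norm_coe, Completion.norm_coe]
      exact (p.star_mul_self x).ge

instance : NormedAlgebra ℂ p.PreCompl where
  norm_smul_le := norm_smul_le

instance [StarModule ℂ D] : StarModule ℂ p.PreCompl where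
  star_smul a x := by
    induction x using Completion.induction_on with
    | hp =>
      exact isClosed_eq (continuous_star.comp (continuous_const_smul a))
        ((continuous_const_smul (star a)).comp continuous_star)
    | ih x => rw [← Completion.coe_smul, ← coe_star, ← coe_star, star_smul, Completion.coe_smul]

instance [StarModule ℂ D] : CStarAlgebra p.PreCompl where

/-- The Hausdorff completion of the `*`-algebra `D` for the `C*`-seminorm `p`. -/
def Compl (p : CStarSeminorm D) : Type u := p.PreCompl

instance [StarModule ℂ D] : CStarAlgebra p.Compl := inferInstanceAs (CStarAlgebra p.PreCompl)

/-- The identity map from `D` to its copy `p.Pre`. -/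
def toPre : D →⋆ₐ[ℂ] p.Pre := StarAlgHom.id ℂ D

/-- A `*`-homomorphism on `D`, seen as a `*`-homomorphism on the copy `p.Pre`. -/
def ofPre {B : Type v} [CStarAlgebra B] (φ : D →⋆ₐ[ℂ] B) : p.Pre →⋆ₐ[ℂ] B := φ

variable [StarModule ℂ D]

/-- The canonical map into the completion. -/
def toPreCompl : D →⋆ₐ[ℂ] p.PreCompl where
  toFun x := (p.toPre x : p.PreCompl)
  map_one' := Completion.coe_one _
  map_mul' x y := Completion.coe_mul (p.toPre x) (p.toPre y)
  map_zero' := Completion.coe_zero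
  map_add' x y := Completion.coe_add (p.toPre x) (p.toPre y)
  commutes' _ := rfl
  map_star' x := p.coe_star (p.toPre x)

/-- The canonical `*`-homomorphism with dense range into the completion. -/
def toCompl : D →⋆ₐ[ℂ] p.Compl := p.toPreCompl

theorem norm_toCompl (x : D) : ‖p.toCompl x‖ = p x := Completion.norm_coe (p.toPre x)

theorem denseRange_toCompl : DenseRange p.toCompl :=
  Completion.denseRange_coe (α := p.Pre)

/-- A `*`-homomorphism that is bounded by `p` extends to the completion (auxiliary form). -/
def preExtend {B : Type v} [CStarAlgebra B] (φ : D →⋆ₐ[ℂ] B) (h : ∀ x, ‖φ x‖ ≤ p x) :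
    p.PreCompl →⋆ₐ[ℂ] B :=
  let ψ : p.Pre →L[ℂ] B :=
    LinearMap.mkContinuous (p.ofPre φ).toAlgHom.toLinearMap 1 (fun x => by simpa using! h x)
  have hψ (x : p.Pre) : ψ.fromCompletion (x : p.PreCompl) = p.ofPre φ x :=
    ψ.fromCompletion_apply_coe x
  { toFun := ψ.fromCompletion
    map_one' := (hψ 1).trans (map_one _)
    map_mul' := fun x y => by
      induction x, y using Completion.induction_on₂ with
      | hp => exact isClosed_eq (by fun_prop) (by fun_prop)
      | ih x y => rw [← Completion.coe_mul, hψ, hψ, hψ, map_mul]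
    map_zero' := map_zero _
    map_add' := map_add _
    commutes' := fun r => (hψ (algebraMap ℂ p.Pre r)).trans (AlgHomClass.commutes _ r)
    map_star' := fun x => by
      induction x using Completion.induction_on with
      | hp => exact isClosed_eq (by fun_prop) (by fun_prop)
      | ih x => rw [← coe_star, hψ, hψ, StarHomClass.map_star] }

/-- A `*`-homomorphism that is bounded by `p` extends to the completion. -/
def extend {B : Type v} [CStarAlgebra B] (φ : D →⋆ₐ[ℂ] B) (h : ∀ x, ‖φ x‖ ≤ p x) :
    p.Compl →⋆ₐ[ℂ] B := p.preExtend φ h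

theorem extend_toCompl {B : Type v} [CStarAlgebra B] (φ : D →⋆ₐ[ℂ] B) (h : ∀ x, ‖φ x‖ ≤ p x)
    (x : D) : p.extend φ h (p.toCompl x) = φ x :=
  ContinuousLinearMap.fromCompletion_apply_coe _ (p.toPre x)

/-- Two `*`-homomorphisms on the completion agree if they agree on `D`. -/
theorem hom_ext {B : Type v} [CStarAlgebra B] {φ ψ : p.Compl →⋆ₐ[ℂ] B}
    (h : ∀ x : D, φ (p.toCompl x) = ψ (p.toCompl x)) : φ = ψ := by
  have hc (χ : p.Compl →⋆ₐ[ℂ] B) : Continuous χ :=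
    AddMonoidHomClass.continuous_of_bound χ 1
      (fun x => by simpa using NonUnitalStarAlgHom.norm_apply_le χ x)
  exact DFunLike.coe_injective (p.denseRange_toCompl.equalizer (hc φ) (hc ψ) (funext h))

end basic

end CStarSeminorm

/-! ### Free `*`-algebras -/

/-- Words in the letters `x` (encoded as `(x, false)`) and `x*` (encoded as `(x, true)`). -/
abbrev StarWord (X : Type u) : Type u := FreeMonoid (X × Bool)

namespace StarWord

variable {X : Type u}

/-- The adjoint of a word: reverse the word and exchange every `x` with `x*`. -/
def adj (w : StarWord X) : StarWord X :=
  FreeMonoid.ofList ((w.toList.map fun l => (l.1, !l.2)).reverse)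

theorem adj_adj (w : StarWord X) : w.adj.adj = w := by
  simp [adj, List.map_reverse, Function.comp_def]

theorem adj_mul (v w : StarWord X) : (v * w).adj = w.adj * v.adj := by
  simp [adj]

end StarWord

/-- The free unital complex `*`-algebra on the set `X`: its elements are the noncommutative
polynomials in the letters `x` and `x*`, for `x` in `X`. -/
def FreeStarAlgebra (X : Type u) : Type u := MonoidAlgebra ℂ (StarWord X)

namespace FreeStarAlgebra

variable {X : Type u}

instance : Ring (FreeStarAlgebra X) := inferInstanceAs (Ring (MonoidAlgebra ℂ (StarWord X)))
instance : Algebra ℂ (FreeStarAlgebra X) :=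
  inferInstanceAs (Algebra ℂ (MonoidAlgebra ℂ (StarWord X)))

/-- The monomial `a w`. -/
def monomial (w : StarWord X) (a : ℂ) : FreeStarAlgebra X := MonoidAlgebra.single w a

theorem monomial_add (w : StarWord X) (a b : ℂ) :
    monomial w (a + b) = monomial w a + monomial w b := MonoidAlgebra.single_add ..

theorem monomial_mul (v w : StarWord X) (a b : ℂ) :
    monomial v a * monomial w b = monomial (v * w) (a * b) := MonoidAlgebra.single_mul_single ..

theorem smul_monomial (c : ℂ) (w : StarWord X) (a : ℂ) :
    c • monomial w a = monomial w (c * a) := MonoidAlgebra.smul_single ..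

@[elab_as_elim]
theorem induction {P : FreeStarAlgebra X → Prop} (x : FreeStarAlgebra X) (zero : P 0)
    (add : ∀ x y, P x → P y → P (x + y)) (monomial : ∀ w a, P (monomial w a)) : P x :=
  MonoidAlgebra.induction_linear x zero (fun x y => add x y) monomial

/-- The involution `∑ a_w w ↦ ∑ conj(a_w) w*`. -/
instance : Star (FreeStarAlgebra X) where
  star x := (MonoidAlgebra.coeff x).sum fun w a => monomial w.adj (star a)

theorem star_monomial (w : StarWord X) (a : ℂ) :
    star (monomial w a) = monomial w.adj (star a) :=
  Finsupp.sum_single_index (by rw [star_zero]; exact MonoidAlgebra.single_zero _)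

theorem star_add' (x y : FreeStarAlgebra X) : star (x + y) = star x + star y :=
  Finsupp.sum_add_index' (fun _ => by rw [star_zero]; exact MonoidAlgebra.single_zero _)
    (fun _ _ _ => by rw [star_add, monomial_add])

theorem star_zero' : star (0 : FreeStarAlgebra X) = 0 := Finsupp.sum_zero_index

instance : StarRing (FreeStarAlgebra X) where
  star_involutive x := by
    induction x using induction with
    | zero => rw [star_zero', star_zero']
    | add x y hx hy => rw [star_add', star_add', hx, hy]
    | monomial w a => rw [star_monomial, star_monomial, star_star, StarWord.adj_adj]
  star_add := star_add'
  star_mul x y := by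
    induction x using induction with
    | zero => rw [zero_mul, star_zero', mul_zero]
    | add x x' hx hx' => rw [add_mul, star_add', star_add', mul_add, hx, hx']
    | monomial v a =>
      induction y using induction with
      | zero => rw [mul_zero, star_zero', zero_mul]
      | add y y' hy hy' => rw [mul_add, star_add', star_add', add_mul, hy, hy']
      | monomial w b =>
        simp only [monomial_mul, star_monomial, StarWord.adj_mul, star_mul]

instance : StarModule ℂ (FreeStarAlgebra X) where
  star_smul c x := by
    induction x using induction with
    | zero => rw [smul_zero, star_zero, smul_zero]
    | add x y hx hy => rw [smul_add, star_add, star_add, smul_add, hx, hy]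
    | monomial w a => rw [smul_monomial, star_monomial, star_monomial, smul_monomial, star_mul,
        mul_comm]

/-- The free generator attached to `x`. -/
def ι (x : X) : FreeStarAlgebra X := monomial (FreeMonoid.of (x, false)) 1

/-- A family of elements of a `*`-algebra defines a `*`-homomorphism on the free `*`-algebra. -/
def lift {B : Type v} [Ring B] [StarRing B] [Algebra ℂ B] [StarModule ℂ B] (f : X → B) :
    FreeStarAlgebra X →⋆ₐ[ℂ] B :=
  let g : StarWord X →* B := FreeMonoid.lift fun l => if l.2 then star (f l.1) else f l.1
  have hg (w : StarWord X) : g w.adj = star (g w) := by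
    induction w using FreeMonoid.inductionOn with
    | one => rw [map_one, star_one]; exact map_one g
    | of l =>
      change g (FreeMonoid.of (l.1, !l.2)) = _
      rcases l with ⟨x, b⟩
      cases b <;> simp [g]
    | mul v w hv hw => rw [StarWord.adj_mul, map_mul, map_mul, star_mul, hv, hw]
  let φ : FreeStarAlgebra X →ₐ[ℂ] B := MonoidAlgebra.lift ℂ B (StarWord X) g
  have hφ (w : StarWord X) (a : ℂ) : φ (monomial w a) = a • g w := MonoidAlgebra.lift_single ..
  { φ with
    map_star' := fun x => by
      change φ (star x) = star (φ x)
      induction x using induction with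
      | zero => rw [star_zero, map_zero, star_zero]
      | add x y hx hy => rw [star_add, map_add, map_add, star_add, hx, hy]
      | monomial w a => rw [star_monomial, hφ, hφ, hg, star_smul] }

@[simp]
theorem lift_ι {B : Type v} [Ring B] [StarRing B] [Algebra ℂ B] [StarModule ℂ B] (f : X → B)
    (x : X) : lift f (ι x) = f x := by
  refine (MonoidAlgebra.lift_single ..).trans ?_
  simp

theorem monomial_of_mul (l : X × Bool) (w : StarWord X) :
    monomial (FreeMonoid.of l * w) 1 =
      (if l.2 then star (ι l.1) else ι l.1) * monomial w 1 := by
  rcases l with ⟨x, b⟩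
  cases b
  · simp [ι, monomial_mul]
  · simp only [if_true, ι, star_monomial, monomial_mul, star_one, mul_one]
    rfl

theorem monomial_one_one : (monomial 1 1 : FreeStarAlgebra X) = 1 := rfl

/-- A subset closed under the `*`-algebra operations that contains the generators is everything. -/
theorem adjoin_ι : StarAlgebra.adjoin ℂ (Set.range (ι : X → FreeStarAlgebra X)) = ⊤ := by
  refine top_unique fun x _ => ?_
  induction x using induction with
  | zero => exact zero_mem _
  | add x y hx hy => exact add_mem (hx trivial) (hy trivial)
  | monomial w a =>
    rw [← mul_one a, ← smul_monomial]
    refine SMulMemClass.smul_mem a ?_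
    induction w using FreeMonoid.inductionOn' with
    | one => rw [monomial_one_one]; exact one_mem _
    | of_mul l w hw0 =>
      rw [monomial_of_mul]
      refine mul_mem ?_ (hw0 trivial)
      split_ifs
      · exact star_mem (StarAlgebra.subset_adjoin ℂ _ ⟨_, rfl⟩)
      · exact StarAlgebra.subset_adjoin ℂ _ ⟨_, rfl⟩

/-- A `C*`-seminorm is controlled by its values on the generators. -/
theorem seminorm_bound (S : Set (CStarSeminorm (FreeStarAlgebra X)))
    (h1 : ∀ x : X, BddAbove (Set.range fun p : S => (p : CStarSeminorm _) (ι x)))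
    (y : FreeStarAlgebra X) : BddAbove (Set.range fun p : S => (p : CStarSeminorm _) y) := by
  have key : ∃ r : ℝ, ∀ p ∈ S, p y ≤ r := by
    have hy : y ∈ StarAlgebra.adjoin ℂ (Set.range (ι : X → FreeStarAlgebra X)) := by
      rw [adjoin_ι]; trivial
    induction hy using StarAlgebra.adjoin_induction with
    | mem y hy =>
      obtain ⟨x, rfl⟩ := hy
      obtain ⟨r, hr⟩ := h1 x
      exact ⟨r, fun p hp => hr ⟨⟨p, hp⟩, rfl⟩⟩
    | algebraMap c =>
      refine ⟨‖c‖, fun p _ => ?_⟩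
      have h2 : p 1 ≤ 1 := by
        have := p.star_mul_self 1
        simp only [star_one, mul_one] at this
        nlinarith [p.nonneg 1]
      rw [Algebra.algebraMap_eq_smul_one, map_smul_eq_mul]
      nlinarith [norm_nonneg c]
    | add x y _ _ hx hy =>
      obtain ⟨r, hr⟩ := hx
      obtain ⟨s, hs⟩ := hy
      exact ⟨r + s, fun p hp => (map_add_le_add p.toSeminorm x y).trans
        (add_le_add (hr p hp) (hs p hp))⟩
    | mul x y _ _ hx hy =>
      obtain ⟨r, hr⟩ := hx
      obtain ⟨s, hs⟩ := hy
      refine ⟨r * s, fun p hp => (p.mul_le x y).trans ?_⟩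
      exact mul_le_mul (hr p hp) (hs p hp) (p.nonneg y) ((p.nonneg x).trans (hr p hp))
    | star x _ hx =>
      obtain ⟨r, hr⟩ := hx
      exact ⟨r, fun p hp => (p.map_star x).trans_le (hr p hp)⟩
  obtain ⟨r, hr⟩ := key
  exact ⟨r, by rintro _ ⟨p, rfl⟩; exact hr p.1 p.2⟩

end FreeStarAlgebra

/-! ### Hilbert space tensor products and the minimal tensor product of `C*`-algebras -/

section HilbertTensor

variable (H : Type u) (K : Type v) [NormedAddCommGroup H] [InnerProductSpace ℂ H]
  [NormedAddCommGroup K] [InnerProductSpace ℂ K]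

/-- The Hilbert space tensor product of `H` and `K`. -/
def HilbertTensor : Type (max u v) := UniformSpace.Completion (H ⊗[ℂ] K)

instance : NormedAddCommGroup (HilbertTensor H K) :=
  inferInstanceAs (NormedAddCommGroup (UniformSpace.Completion (H ⊗[ℂ] K)))
instance : InnerProductSpace ℂ (HilbertTensor H K) :=
  inferInstanceAs (InnerProductSpace ℂ (UniformSpace.Completion (H ⊗[ℂ] K)))
instance : CompleteSpace (HilbertTensor H K) :=
  inferInstanceAs (CompleteSpace (UniformSpace.Completion (H ⊗[ℂ] K)))

variable {H K}

/-- The inclusion of the algebraic tensor product. -/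
def HilbertTensor.of : H ⊗[ℂ] K →ₗᵢ[ℂ] HilbertTensor H K :=
  (UniformSpace.Completion.toComplₗᵢ : H ⊗[ℂ] K →ₗᵢ[ℂ] UniformSpace.Completion (H ⊗[ℂ] K))

open HilbertTensor (of)

theorem HilbertTensor.denseRange_of : DenseRange (of : H ⊗[ℂ] K → HilbertTensor H K) :=
  UniformSpace.Completion.denseRange_coe

/-- The bounded operator `S ⊗ T` on the Hilbert space tensor product. -/
def tensorOp (S : H →L[ℂ] H) (T : K →L[ℂ] K) : HilbertTensor H K →L[ℂ] HilbertTensor H K :=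
  ((TensorProduct.mapL S T).completion :
    UniformSpace.Completion (H ⊗[ℂ] K) →L[ℂ] UniformSpace.Completion (H ⊗[ℂ] K))

theorem tensorOp_of (S : H →L[ℂ] H) (T : K →L[ℂ] K) (x : H ⊗[ℂ] K) :
    tensorOp S T (of x) = of (TensorProduct.mapL S T x) :=
  ContinuousLinearMap.completion_apply_coe _ _

@[simp]
theorem tensorOp_of_tmul (S : H →L[ℂ] H) (T : K →L[ℂ] K) (x : H) (y : K) :
    tensorOp S T (of (x ⊗ₜ y)) = of (S x ⊗ₜ T y) :=
  tensorOp_of S T (x ⊗ₜ y)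

theorem hilbertTensor_ext {S T : HilbertTensor H K →L[ℂ] HilbertTensor H K}
    (h : ∀ (x : H) (y : K), S (of (x ⊗ₜ[ℂ] y)) = T (of (x ⊗ₜ[ℂ] y))) : S = T := by
  refine DFunLike.coe_injective (HilbertTensor.denseRange_of.equalizer S.continuous T.continuous
    (funext fun z => ?_))
  simp only [Function.comp_apply]
  induction z using TensorProduct.induction_on with
  | zero => simp
  | tmul x y => exact h x y
  | add x y hx hy => rw [map_add, map_add, map_add, hx, hy]

theorem tensorOp_mul (S S' : H →L[ℂ] H) (T T' : K →L[ℂ] K) :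
    tensorOp (S * S') (T * T') = tensorOp S T * tensorOp S' T' :=
  hilbertTensor_ext fun x y => by simp

theorem tensorOp_one : tensorOp (1 : H →L[ℂ] H) (1 : K →L[ℂ] K) = 1 :=
  hilbertTensor_ext fun x y => by simp

theorem tensorOp_add_left (S S' : H →L[ℂ] H) (T : K →L[ℂ] K) :
    tensorOp (S + S') T = tensorOp S T + tensorOp S' T :=
  hilbertTensor_ext fun x y => by simp [TensorProduct.add_tmul]

theorem tensorOp_add_right (S : H →L[ℂ] H) (T T' : K →L[ℂ] K) :
    tensorOp S (T + T') = tensorOp S T + tensorOp S T' :=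
  hilbertTensor_ext fun x y => by simp [TensorProduct.tmul_add]

theorem tensorOp_smul_left (a : ℂ) (S : H →L[ℂ] H) (T : K →L[ℂ] K) :
    tensorOp (a • S) T = a • tensorOp S T :=
  hilbertTensor_ext fun x y => by simp [← TensorProduct.smul_tmul']

theorem tensorOp_smul_right (a : ℂ) (S : H →L[ℂ] H) (T : K →L[ℂ] K) :
    tensorOp S (a • T) = a • tensorOp S T :=
  hilbertTensor_ext fun x y => by simp [TensorProduct.tmul_smul]

theorem tensorOp_zero_left (T : K →L[ℂ] K) : tensorOp (0 : H →L[ℂ] H) T = 0 :=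
  hilbertTensor_ext fun x y => by simp

theorem tensorOp_zero_right (S : H →L[ℂ] H) : tensorOp S (0 : K →L[ℂ] K) = 0 :=
  hilbertTensor_ext fun x y => by simp

theorem star_tensorOp [CompleteSpace H] [CompleteSpace K] (S : H →L[ℂ] H) (T : K →L[ℂ] K) :
    star (tensorOp S T) = tensorOp (star S) (star T) := by
  symm
  refine (ContinuousLinearMap.eq_adjoint_iff _ _).mpr fun x y => ?_
  refine HilbertTensor.denseRange_of.induction_on₂
    (p := fun x y => inner ℂ (tensorOp (star S) (star T) x) y = inner ℂ x (tensorOp S T y))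
    (isClosed_eq (by fun_prop) (by fun_prop)) (fun x y => ?_) x y
  · rw [tensorOp_of, tensorOp_of, LinearIsometry.inner_map_map, LinearIsometry.inner_map_map]
    induction x using TensorProduct.induction_on with
    | zero => simp
    | add x x' hx hx' => rw [map_add, inner_add_left, inner_add_left, hx, hx']
    | tmul a b =>
      induction y using TensorProduct.induction_on with
      | zero => simp
      | add y y' hy hy' => rw [map_add, inner_add_right, inner_add_right, hy, hy']
      | tmul c d =>
        simp [ContinuousLinearMap.star_eq_adjoint, ContinuousLinearMap.adjoint_inner_left]

variable (H K) in
/-- The `*`-homomorphism `S ↦ S ⊗ 1`. -/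
def leftAmp [CompleteSpace H] [CompleteSpace K] :
    (H →L[ℂ] H) →⋆ₐ[ℂ] (HilbertTensor H K →L[ℂ] HilbertTensor H K) where
  toFun S := tensorOp S 1
  map_one' := tensorOp_one
  map_mul' S S' := by rw [← tensorOp_mul, mul_one]
  map_zero' := tensorOp_zero_left 1
  map_add' S S' := tensorOp_add_left S S' 1
  commutes' a := by
    rw [Algebra.algebraMap_eq_smul_one, tensorOp_smul_left, tensorOp_one,
      Algebra.algebraMap_eq_smul_one]
  map_star' S := by rw [star_tensorOp, star_one]

variable (H K) in
/-- The `*`-homomorphism `T ↦ 1 ⊗ T`. -/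
def rightAmp [CompleteSpace H] [CompleteSpace K] :
    (K →L[ℂ] K) →⋆ₐ[ℂ] (HilbertTensor H K →L[ℂ] HilbertTensor H K) where
  toFun T := tensorOp 1 T
  map_one' := tensorOp_one
  map_mul' S S' := by rw [← tensorOp_mul, mul_one]
  map_zero' := tensorOp_zero_right 1
  map_add' S S' := tensorOp_add_right 1 S S'
  commutes' a := by
    rw [Algebra.algebraMap_eq_smul_one, tensorOp_smul_right, tensorOp_one,
      Algebra.algebraMap_eq_smul_one]
  map_star' S := by rw [star_tensorOp, star_one]

end HilbertTensor

/-- A representation of a unital `C*`-algebra on a Hilbert space. -/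
structure HilbertRep (A : Type u) [CStarAlgebra A] : Type (u + 1) where
  space : Type u
  [normed : NormedAddCommGroup space]
  [inner : InnerProductSpace ℂ space]
  [complete : CompleteSpace space]
  hom : A →⋆ₐ[ℂ] (space →L[ℂ] space)

attribute [instance] HilbertRep.normed HilbertRep.inner HilbertRep.complete

/-- The algebraic tensor product of two `*`-algebras is a `*`-algebra. -/
instance tensorStarRing {A : Type u} {B : Type v} [Ring A] [StarRing A] [Algebra ℂ A]
    [StarModule ℂ A] [Ring B] [StarRing B] [Algebra ℂ B] [StarModule ℂ B] :
    StarRing (A ⊗[ℂ] B) where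
  star_add := star_add
  star_mul x y := by
    induction x using TensorProduct.induction_on with
    | zero => simp
    | add x x' hx hx' => rw [add_mul, star_add, star_add, mul_add, hx, hx']
    | tmul a b =>
      induction y using TensorProduct.induction_on with
      | zero => simp
      | add y y' hy hy' => rw [mul_add, star_add, star_add, add_mul, hy, hy']
      | tmul c d => simp

section MinTensor

variable {A A' : Type u} {B B' : Type v} [CStarAlgebra A] [CStarAlgebra B]
  [CStarAlgebra A'] [CStarAlgebra B']

/-- The algebra homomorphism underlying `tensorRep`. -/
def tensorRepAux (π : HilbertRep A) (ρ : HilbertRep B) :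
    A ⊗[ℂ] B →ₐ[ℂ]
      (HilbertTensor π.space ρ.space →L[ℂ] HilbertTensor π.space ρ.space) :=
  Algebra.TensorProduct.lift
    ((leftAmp π.space ρ.space).comp π.hom).toAlgHom
    ((rightAmp π.space ρ.space).comp ρ.hom).toAlgHom
    (fun a b => by
      change tensorOp (π.hom a) 1 * tensorOp 1 (ρ.hom b) =
        tensorOp 1 (ρ.hom b) * tensorOp (π.hom a) 1
      rw [← tensorOp_mul, ← tensorOp_mul]; simp only [mul_one, one_mul])

theorem tensorRepAux_tmul (π : HilbertRep A) (ρ : HilbertRep B) (a : A) (b : B) :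
    tensorRepAux π ρ (a ⊗ₜ b) = tensorOp (π.hom a) (ρ.hom b) := by
  refine (Algebra.TensorProduct.lift_tmul _ _ _ a b).trans ?_
  change tensorOp (π.hom a) 1 * tensorOp 1 (ρ.hom b) = _
  rw [← tensorOp_mul]; simp only [mul_one, one_mul]

/-- The representation `a ⊗ b ↦ π(a) ⊗ ρ(b)` of the algebraic tensor product. -/
def tensorRep (π : HilbertRep A) (ρ : HilbertRep B) :
    A ⊗[ℂ] B →⋆ₐ[ℂ]
      (HilbertTensor π.space ρ.space →L[ℂ] HilbertTensor π.space ρ.space) where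
  __ := tensorRepAux π ρ
  map_star' x := by
    change tensorRepAux π ρ (star x) = star (tensorRepAux π ρ x)
    induction x using TensorProduct.induction_on with
    | zero => simp
    | add x y hx hy => rw [star_add, map_add, map_add, star_add, hx, hy]
    | tmul a b =>
      rw [TensorProduct.star_tmul, tensorRepAux_tmul, tensorRepAux_tmul, star_tensorOp,
        StarHomClass.map_star, StarHomClass.map_star]

theorem tensorRep_tmul (π : HilbertRep A) (ρ : HilbertRep B) (a : A) (b : B) :
    tensorRep π ρ (a ⊗ₜ b) = tensorOp (π.hom a) (ρ.hom b) := tensorRepAux_tmul π ρ a b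

theorem norm_tensorRep_tmul_le (π : HilbertRep A) (ρ : HilbertRep B) (a : A) (b : B) :
    ‖tensorRep π ρ (a ⊗ₜ b)‖ ≤ ‖a‖ * ‖b‖ := by
  have h : tensorRep π ρ (a ⊗ₜ b) = (leftAmp π.space ρ.space).comp π.hom a *
      (rightAmp π.space ρ.space).comp ρ.hom b := by
    rw [tensorRep_tmul]
    change _ = tensorOp (π.hom a) 1 * tensorOp 1 (ρ.hom b)
    rw [← tensorOp_mul]; simp only [mul_one, one_mul]
  rw [h]
  exact (norm_mul_le _ _).trans (mul_le_mul (NonUnitalStarAlgHom.norm_apply_le _ a)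
    (NonUnitalStarAlgHom.norm_apply_le _ b) (norm_nonneg _) (norm_nonneg _))

variable (A B) in
/-- The seminorms `x ↦ ‖(π ⊗ ρ)(x)‖` on the algebraic tensor product. -/
def spatialSeminorms : Set (CStarSeminorm (A ⊗[ℂ] B)) :=
  {p | ∃ (π : HilbertRep A) (ρ : HilbertRep B), p = CStarSeminorm.ofStarAlgHom (tensorRep π ρ)}

theorem spatial_bdd (x : A ⊗[ℂ] B) :
    BddAbove (Set.range fun p : spatialSeminorms A B => (p : CStarSeminorm _) x) := by
  have key : ∃ r : ℝ, ∀ (π : HilbertRep A) (ρ : HilbertRep B), ‖tensorRep π ρ x‖ ≤ r := by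
    induction x using TensorProduct.induction_on with
    | zero => exact ⟨0, fun π ρ => by rw [map_zero, norm_zero]⟩
    | tmul a b => exact ⟨‖a‖ * ‖b‖, fun π ρ => norm_tensorRep_tmul_le π ρ a b⟩
    | add x y hx hy =>
      obtain ⟨r, hr⟩ := hx
      obtain ⟨s, hs⟩ := hy
      refine ⟨r + s, fun π ρ => ?_⟩
      rw [map_add]
      exact (norm_add_le _ _).trans (add_le_add (hr π ρ) (hs π ρ))
  obtain ⟨r, hr⟩ := key
  refine ⟨r, ?_⟩
  rintro _ ⟨⟨_, π, ρ, rfl⟩, rfl⟩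
  exact hr π ρ

variable (A B) in
/-- The spatial (minimal) `C*`-norm on the algebraic tensor product:
`‖x‖ = sup ‖(π ⊗ ρ)(x)‖` over all representations `π` of `A` and `ρ` of `B`. -/
def spatialNorm : CStarSeminorm (A ⊗[ℂ] B) :=
  CStarSeminorm.sup (spatialSeminorms A B) spatial_bdd

variable (A B) in
/-- The minimal `C*`-algebraic tensor product. -/
abbrev MinTensor : Type (max u v) := (spatialNorm A B).Compl

/-- The elementary tensor `a ⊗ b` in the minimal tensor product. -/
def minTmul (a : A) (b : B) : MinTensor A B := (spatialNorm A B).toCompl (a ⊗ₜ[ℂ] b)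

/-- The `*`-homomorphism `φ ⊗ ψ` between algebraic tensor products. -/
def algTensorMap (φ : A →⋆ₐ[ℂ] A') (ψ : B →⋆ₐ[ℂ] B') : A ⊗[ℂ] B →⋆ₐ[ℂ] A' ⊗[ℂ] B' where
  __ := Algebra.TensorProduct.map φ.toAlgHom ψ.toAlgHom
  map_star' x := by
    change Algebra.TensorProduct.map φ.toAlgHom ψ.toAlgHom (star x) =
      star (Algebra.TensorProduct.map φ.toAlgHom ψ.toAlgHom x)
    induction x using TensorProduct.induction_on with
    | zero => simp
    | add x y hx hy => rw [star_add, map_add, map_add, star_add, hx, hy]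
    | tmul a b => simp [map_star]

theorem algTensorMap_tmul (φ : A →⋆ₐ[ℂ] A') (ψ : B →⋆ₐ[ℂ] B') (a : A) (b : B) :
    algTensorMap φ ψ (a ⊗ₜ b) = φ a ⊗ₜ ψ b := rfl

/-- Restriction of a representation along a `*`-homomorphism. -/
def HilbertRep.comap (π : HilbertRep A') (φ : A →⋆ₐ[ℂ] A') : HilbertRep A where
  space := π.space
  hom := π.hom.comp φ

theorem tensorRep_algTensorMap (φ : A →⋆ₐ[ℂ] A') (ψ : B →⋆ₐ[ℂ] B') (π : HilbertRep A')
    (ρ : HilbertRep B') (x : A ⊗[ℂ] B) :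
    tensorRep π ρ (algTensorMap φ ψ x) = tensorRep (π.comap φ) (ρ.comap ψ) x := by
  induction x using TensorProduct.induction_on with
  | zero => rw [map_zero, map_zero]; exact (map_zero _).symm
  | add x y hx hy => rw [map_add, map_add, hx, hy]; exact (map_add _ x y).symm
  | tmul a b => rw [algTensorMap_tmul, tensorRep_tmul]; exact (tensorRep_tmul ..).symm

/-- The `*`-homomorphism `φ ⊗ ψ` between minimal tensor products. -/
def minTensorMap (φ : A →⋆ₐ[ℂ] A') (ψ : B →⋆ₐ[ℂ] B') : MinTensor A B →⋆ₐ[ℂ] MinTensor A' B' :=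
  (spatialNorm A B).extend ((spatialNorm A' B').toCompl.comp (algTensorMap φ ψ)) (fun x => by
    rw [StarAlgHom.comp_apply, CStarSeminorm.norm_toCompl]
    refine CStarSeminorm.sup_le _ (CStarSeminorm.nonneg _ x) ?_
    rintro _ ⟨π, ρ, rfl⟩
    rw [CStarSeminorm.ofStarAlgHom_apply, tensorRep_algTensorMap]
    exact CStarSeminorm.le_sup (p := CStarSeminorm.ofStarAlgHom (tensorRep (π.comap φ) (ρ.comap ψ)))
      spatial_bdd ⟨_, _, rfl⟩ x)

theorem minTensorMap_tmul (φ : A →⋆ₐ[ℂ] A') (ψ : B →⋆ₐ[ℂ] B') (a : A) (b : B) :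
    minTensorMap φ ψ (minTmul a b) = minTmul (φ a) (ψ b) :=
  CStarSeminorm.extend_toCompl ..

end MinTensor

/-! ### Representations that do not vanish on a given projection -/

section States

variable {A : Type u} [CStarAlgebra A]

theorem im_eq_zero_of_contraction (h : A →L[ℂ] ℂ) (hn : ∀ a, ‖h a‖ ≤ ‖a‖) (h1 : h 1 = 1)
    (a : A) (ha : IsSelfAdjoint a) : (h a).im = 0 := by
  have key (s : ℝ) : ((h a).im + s) ^ 2 ≤ ‖a‖ ^ 2 * 1 + s ^ 2 * ‖(1 : A)‖ := by
    have e : star (a + (Complex.I * s) • (1 : A)) * (a + (Complex.I * s) • (1 : A)) =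
        a * a + ((s : ℂ) ^ 2) • (1 : A) := by
      simp only [star_add, ha.star_eq, star_smul, star_one, add_mul, mul_add, 
        mul_smul_comm, smul_mul_assoc, one_mul, mul_one, RCLike.star_def, map_mul, Complex.conj_I,
        Complex.conj_ofReal]
      have : -Complex.I * s * (Complex.I * s) = (s : ℂ) ^ 2 := by
        linear_combination (-(s : ℂ) ^ 2) * Complex.I_mul_I
      rw [smul_add, smul_smul, mul_comm (Complex.I * (s : ℂ)) (-Complex.I * s), this]
      simp only [neg_mul, neg_smul]
      abel
    have n1 : ‖a + (Complex.I * s) • (1 : A)‖ ^ 2 ≤ ‖a‖ ^ 2 + s ^ 2 * ‖(1 : A)‖ := by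
      rw [sq, ← CStarRing.norm_star_mul_self, e]
      refine (norm_add_le _ _).trans ?_
      rw [norm_smul, norm_pow, Complex.norm_real, Real.norm_eq_abs, sq_abs]
      gcongr
      exact (norm_mul_le a a).trans_eq (sq _).symm
    have n2 : ((h a).im + s) ^ 2 ≤ ‖h (a + (Complex.I * s) • (1 : A))‖ ^ 2 := by
      have : (h (a + (Complex.I * s) • (1 : A))).im = (h a).im + s := by
        simp [h1]
      rw [← this]
      have := Complex.abs_im_le_norm (h (a + (Complex.I * s) • (1 : A)))
      rw [← sq_abs]
      gcongr
    refine n2.trans ((pow_le_pow_left₀ (norm_nonneg _) (hn _) 2).trans ?_)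
    linarith
  have hone : ‖(1 : A)‖ = 1 := by
    rcases subsingleton_or_nontrivial A with hA | hA
    · have : h 1 = 0 := by rw [Subsingleton.elim (1 : A) 0, map_zero]
      rw [this] at h1; norm_num at h1
    · exact norm_one
  rw [hone] at key
  by_contra hne
  have k := key (‖a‖ ^ 2 / (h a).im)
  have e2 : (h a).im * (‖a‖ ^ 2 / (h a).im) = ‖a‖ ^ 2 := by field_simp
  have : 0 < (h a).im ^ 2 := by positivity
  nlinarith [sq_nonneg ‖a‖]

theorem nonneg_of_contraction [PartialOrder A] [StarOrderedRing A] (h : A →L[ℂ] ℂ)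
    (hn : ∀ a, ‖h a‖ ≤ ‖a‖) (h1 : h 1 = 1) (a : A) (ha : 0 ≤ a) : 0 ≤ h a := by
  have hs : IsSelfAdjoint a := IsSelfAdjoint.of_nonneg ha
  have him := im_eq_zero_of_contraction h hn h1 a hs
  rw [Complex.nonneg_iff]
  refine ⟨?_, him.symm⟩
  have k1 : ‖algebraMap ℝ A ‖a‖ - a‖ ≤ ‖a‖ := by
    have l1 : a ≤ algebraMap ℝ A ‖a‖ := hs.le_algebraMap_norm_self
    rw [CStarAlgebra.norm_le_iff_le_algebraMap _ (norm_nonneg a) (sub_nonneg.mpr l1)]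
    exact sub_le_self _ ha
  have k2 := (hn _).trans k1
  have k3 : h (algebraMap ℝ A ‖a‖ - a) = ‖a‖ - h a := by
    rw [map_sub, Algebra.algebraMap_eq_smul_one, ← Complex.coe_smul, map_smul, h1]
    simp
  rw [k3] at k2
  have k4 := (Complex.re_le_norm _).trans k2
  simp at k4
  exact k4

/-- A nonzero projection is nonzero in some representation. -/
theorem exists_positive_ne_zero [PartialOrder A] [StarOrderedRing A] (p : A) (hp : star p = p)
    (hpp : p * p = p) (h0 : p ≠ 0) : ∃ f : A →ₚ[ℂ] ℂ, f p ≠ 0 := by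
  have hnorm : ‖p‖ = 1 := by
    have := CStarRing.norm_star_mul_self (x := p)
    rw [hp, hpp] at this
    have h2 : ‖p‖ ≠ 0 := norm_ne_zero_iff.mpr h0
    field_simp at this
    exact this.symm
  obtain ⟨g, hg, hgp⟩ := exists_dual_vector ℂ p (norm_ne_zero_iff.mpr h0)
  let h : A →L[ℂ] ℂ := g ∘L ((ContinuousLinearMap.mul ℂ A p) ∘L
    ((ContinuousLinearMap.mul ℂ A).flip p))
  have hh (a : A) : h a = g (p * (a * p)) := rfl
  have hn (a : A) : ‖h a‖ ≤ ‖a‖ := by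
    rw [hh]
    refine (g.le_opNorm _).trans ?_
    rw [hg, one_mul]
    refine (norm_mul_le _ _).trans ?_
    rw [hnorm, one_mul]
    refine (norm_mul_le _ _).trans ?_
    rw [hnorm, mul_one]
  have h1 : h 1 = 1 := by rw [hh, one_mul, hpp, hgp, hnorm]; simp
  refine ⟨PositiveLinearMap.mk₀ (h : A →ₗ[ℂ] ℂ) (nonneg_of_contraction h hn h1), ?_⟩
  change h p ≠ 0
  rw [hh, hpp, hpp, hgp, hnorm]
  simp

theorem exists_rep_ne_zero (p : A) (hp : star p = p) (hpp : p * p = p) (h0 : p ≠ 0) :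
    ∃ (H : Type u) (_ : NormedAddCommGroup H) (_ : InnerProductSpace ℂ H) (_ : CompleteSpace H)
      (π : A →⋆ₐ[ℂ] (H →L[ℂ] H)), π p ≠ 0 := by
  let _ : PartialOrder A := CStarAlgebra.spectralOrder A
  have _ : StarOrderedRing A := CStarAlgebra.spectralOrderedRing A
  obtain ⟨f, hf⟩ := exists_positive_ne_zero p hp hpp h0
  refine ⟨f.GNS, inferInstance, inferInstance, inferInstance, f.gnsStarAlgHom, fun h => hf ?_⟩
  have e : f.gnsStarAlgHom p ((f.toPreGNS 1 : f.PreGNS) : f.GNS) = (f.toPreGNS p : f.PreGNS) := by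
    refine (f.gnsNonUnitalStarAlgHom_apply_coe).trans ?_
    rw [f.leftMulMapPreGNS_apply]
    simp
  rw [h] at e
  have e2 : ‖f.toPreGNS p‖ = 0 := by
    rw [← UniformSpace.Completion.norm_coe, ← e]
    exact norm_zero
  have e3 := f.preGNS_norm_sq (f.toPreGNS p)
  rw [e2, PositiveLinearMap.ofPreGNS_toPreGNS, hp, hpp] at e3
  rw [← e3]
  simp

end States

/-! ### Compact matrix quantum groups -/

/-- A compact matrix quantum group whose fundamental representation is indexed by `n`. -/
structure CompactMatrixQuantumGroup (n : Type v) [Fintype n] [DecidableEq n] :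
    Type (max (u + 1) v) where
  /-- The `C*`-algebra `C(𝔾)`. -/
  algebra : Type u
  [cstarAlgebra : CStarAlgebra algebra]
  /-- The fundamental representation. -/
  u : Matrix n n algebra
  /-- The entries of `u` generate `C(𝔾)` as a `C*`-algebra. -/
  generates : (StarAlgebra.adjoin ℂ (Set.range fun ij : n × n => u ij.1 ij.2)).topologicalClosure
    = ⊤
  isUnit_u : IsUnit u
  isUnit_u_star : IsUnit (u.map star)
  /-- The comultiplication. -/
  comul : algebra →⋆ₐ[ℂ] MinTensor algebra algebra
  comul_u : ∀ i j, comul (u i j) = ∑ k, minTmul (u i k) (u k j)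

attribute [instance] CompactMatrixQuantumGroup.cstarAlgebra

/-- Isomorphism of (the compact quantum groups underlying) two compact matrix quantum groups: a
`*`-isomorphism `φ : C(𝔾) → C(ℍ)` with `(φ ⊗ φ) ∘ Δ = Δ ∘ φ`. -/
def CompactMatrixQuantumGroup.Isomorphic {n : Type v} {m : Type w} [Fintype n] [DecidableEq n] [Fintype m]
    [DecidableEq m] (G : CompactMatrixQuantumGroup.{u} n) (H : CompactMatrixQuantumGroup.{u} m) :
    Prop :=
  ∃ φ : G.algebra ≃⋆ₐ[ℂ] H.algebra, ∀ a : G.algebra,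
    minTensorMap (φ : G.algebra →⋆ₐ[ℂ] H.algebra) (φ : G.algebra →⋆ₐ[ℂ] H.algebra) (G.comul a) =
      H.comul (φ a)

/-! ### Universal `C*`-algebras -/

section Universal

variable {X : Type u}

/-- The `C*`-seminorms on the free `*`-algebra that vanish on the relators in `R`. -/
def relSeminorms (R : Set (FreeStarAlgebra X)) : Set (CStarSeminorm (FreeStarAlgebra X)) :=
  {p | ∀ r ∈ R, p r = 0}

/-- The relators `R` bound the norms of the generators, so that the universal `C*`-algebra
exists. -/
def IsBoundedRel (R : Set (FreeStarAlgebra X)) : Prop :=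
  ∀ x : X, BddAbove (Set.range fun p : relSeminorms R =>
    (p : CStarSeminorm (FreeStarAlgebra X)) (FreeStarAlgebra.ι x))

/-- The largest `C*`-seminorm on the free `*`-algebra that vanishes on the relators. -/
def universalSeminorm (R : Set (FreeStarAlgebra X)) (hR : IsBoundedRel R) :
    CStarSeminorm (FreeStarAlgebra X) :=
  CStarSeminorm.sup (relSeminorms R) (FreeStarAlgebra.seminorm_bound _ hR)

/-- The universal unital `C*`-algebra with generators `X` and relations `r = 0` for `r ∈ R`. -/
def UniversalCStar (R : Set (FreeStarAlgebra X)) (hR : IsBoundedRel R) : Type u :=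
  (universalSeminorm R hR).Compl

namespace UniversalCStar

variable {R : Set (FreeStarAlgebra X)} {hR : IsBoundedRel R}

instance : CStarAlgebra (UniversalCStar R hR) :=
  inferInstanceAs (CStarAlgebra (universalSeminorm R hR).Compl)

variable (R hR) in
/-- The canonical map from the free `*`-algebra. -/
def mk : FreeStarAlgebra X →⋆ₐ[ℂ] UniversalCStar R hR := (universalSeminorm R hR).toCompl

variable (R hR) in
/-- The generators. -/
def gen (x : X) : UniversalCStar R hR := mk R hR (FreeStarAlgebra.ι x)

theorem mk_rel {r : FreeStarAlgebra X} (hr : r ∈ R) : mk R hR r = 0 := by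
  rw [← norm_eq_zero]
  refine ((universalSeminorm R hR).norm_toCompl r).trans (le_antisymm ?_ (CStarSeminorm.nonneg _ _))
  exact CStarSeminorm.sup_le _ le_rfl fun p hp => (hp r hr).le

/-- The universal property. -/
def lift {B : Type v} [CStarAlgebra B] (f : X → B)
    (hf : ∀ r ∈ R, FreeStarAlgebra.lift f r = 0) : UniversalCStar R hR →⋆ₐ[ℂ] B :=
  (universalSeminorm R hR).extend (FreeStarAlgebra.lift f) fun x =>
    CStarSeminorm.le_sup (p := CStarSeminorm.ofStarAlgHom (FreeStarAlgebra.lift f)) _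
      (fun r hr => by rw [CStarSeminorm.ofStarAlgHom_apply, hf r hr, norm_zero]) x

theorem lift_gen {B : Type v} [CStarAlgebra B] (f : X → B)
    (hf : ∀ r ∈ R, FreeStarAlgebra.lift f r = 0) (x : X) :
    lift (hR := hR) f hf (gen R hR x) = f x :=
  (CStarSeminorm.extend_toCompl _ _ _ _).trans (FreeStarAlgebra.lift_ι f x)

theorem generates :
    (StarAlgebra.adjoin ℂ (Set.range (gen R hR))).topologicalClosure = ⊤ := by
  refine top_unique fun y _ => ?_
  have h1 (x : FreeStarAlgebra X) : mk R hR x ∈ StarAlgebra.adjoin ℂ (Set.range (gen R hR)) := by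
    have hx : x ∈ StarAlgebra.adjoin ℂ (Set.range (FreeStarAlgebra.ι : X → FreeStarAlgebra X)) := by
      rw [FreeStarAlgebra.adjoin_ι]; trivial
    induction hx using StarAlgebra.adjoin_induction with
    | mem x hx =>
      obtain ⟨x, rfl⟩ := hx
      exact StarAlgebra.subset_adjoin ℂ _ ⟨x, rfl⟩
    | algebraMap c => rw [AlgHomClass.commutes]; exact algebraMap_mem _ c
    | add x y _ _ hx hy => rw [map_add]; exact add_mem hx hy
    | mul x y _ _ hx hy => rw [map_mul]; exact mul_mem hx hy
    | star x _ hx => rw [map_star]; exact star_mem hx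
  have h2 : y ∈ closure (Set.range (mk R hR)) :=
    (universalSeminorm R hR).denseRange_toCompl y
  rw [← SetLike.mem_coe, StarSubalgebra.topologicalClosure_coe]
  refine closure_mono ?_ h2
  rintro _ ⟨x, rfl⟩
  exact h1 x

end UniversalCStar

end Universal

/-! ### Quantum automorphism groups of colored graphs -/

section Qut

variable {V : Type u} {C : Type v} [Fintype V]

/-- The relators of the quantum automorphism group of the graph `X` with vertex coloring `c`;
the generator with index `(i, j)` is the entry `u i j` of the fundamental representation. -/
inductive QutRel (X : SimpleGraph V) (c : V → C) : FreeStarAlgebra (V × V) → Prop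
  | star (i j : V) :
      QutRel X c (star (FreeStarAlgebra.ι (i, j)) - FreeStarAlgebra.ι (i, j))
  | idem (i j : V) :
      QutRel X c (FreeStarAlgebra.ι (i, j) * FreeStarAlgebra.ι (i, j) - FreeStarAlgebra.ι (i, j))
  | row (i : V) : QutRel X c (∑ k, FreeStarAlgebra.ι (i, k) - 1)
  | col (j : V) : QutRel X c (∑ k, FreeStarAlgebra.ι (k, j) - 1)
  | adj (i j k l : V) (h : (X.Adj i k ∧ ¬ X.Adj j l) ∨ (¬ X.Adj i k ∧ X.Adj j l)) :
      QutRel X c (FreeStarAlgebra.ι (i, j) * FreeStarAlgebra.ι (k, l))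
  | color (i j : V) (h : c i ≠ c j) : QutRel X c (FreeStarAlgebra.ι (i, j))

/-- The set of relators of `Qut_c(X)`. -/
def qutRelators (X : SimpleGraph V) (c : V → C) : Set (FreeStarAlgebra (V × V)) :=
  {r | QutRel X c r}

/-- The family `v` of elements of a `*`-algebra satisfies the relations of the quantum automorphism
group of the colored graph `(X, c)`. -/
structure IsQutFamily (X : SimpleGraph V) (c : V → C) {B : Type*} [Ring B] [StarRing B]
    (v : V → V → B) : Prop where
  star_eq : ∀ i j, star (v i j) = v i j
  idem : ∀ i j, v i j * v i j = v i j
  row : ∀ i, ∑ k, v i k = 1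
  col : ∀ j, ∑ k, v k j = 1
  adj : ∀ i j k l, (X.Adj i k ∧ ¬ X.Adj j l) ∨ (¬ X.Adj i k ∧ X.Adj j l) → v i j * v k l = 0
  color : ∀ i j, c i ≠ c j → v i j = 0

theorem lift_qutRel_iff {X : SimpleGraph V} {c : V → C} {B : Type*} [Ring B] [StarRing B]
    [Algebra ℂ B] [StarModule ℂ B] (f : V × V → B) :
    (∀ r ∈ qutRelators X c, FreeStarAlgebra.lift f r = 0) ↔
      IsQutFamily X c fun i j => f (i, j) := by
  constructor
  · intro h
    have h' (r) (hr : QutRel X c r) : FreeStarAlgebra.lift f r = 0 := h r hr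
    exact
      { star_eq := fun i j => by simpa [map_star, sub_eq_zero] using h' _ (.star i j)
        idem := fun i j => by simpa [sub_eq_zero] using h' _ (.idem i j)
        row := fun i => by simpa [sub_eq_zero] using h' _ (.row i)
        col := fun j => by simpa [sub_eq_zero] using h' _ (.col j)
        adj := fun i j k l hh => by simpa using h' _ (.adj i j k l hh)
        color := fun i j hh => by simpa using h' _ (.color i j hh) }
  · rintro h _ (⟨i, j⟩ | ⟨i, j⟩ | i | j | ⟨i, j, k, l, hh⟩ | ⟨i, j, hh⟩)
    · simpa [map_star, sub_eq_zero] using h.star_eq i j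
    · simpa [sub_eq_zero] using h.idem i j
    · simpa [sub_eq_zero] using h.row i
    · simpa [sub_eq_zero] using h.col j
    · simpa using h.adj i j k l hh
    · simpa using h.color i j hh

theorem isBoundedRel_qutRel (X : SimpleGraph V) (c : V → C) :
    IsBoundedRel (qutRelators X c) := by
  rintro ⟨i, j⟩
  refine ⟨1, ?_⟩
  rintro _ ⟨⟨p, hp⟩, rfl⟩
  change p (FreeStarAlgebra.ι (i, j)) ≤ 1
  have h1 : p (star (FreeStarAlgebra.ι (i, j)) - FreeStarAlgebra.ι (i, j)) = 0 := hp _ (.star i j)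
  have h2 : p (FreeStarAlgebra.ι (i, j) * FreeStarAlgebra.ι (i, j) - FreeStarAlgebra.ι (i, j)) = 0 :=
    hp _ (.idem i j)
  have h3 := p.star_mul_self (FreeStarAlgebra.ι (i, j))
  set a : FreeStarAlgebra (V × V) := FreeStarAlgebra.ι (i, j) with ha
  have h4 : star a * a = (star a - a) * a + (a * a - a) + a := by noncomm_ring
  have h5 : p (star a * a) ≤ p a := by
    rw [h4]
    refine (map_add_le_add p.toSeminorm _ _).trans ?_
    refine (add_le_add_left (map_add_le_add p.toSeminorm _ _) _).trans ?_
    have h6 := p.mul_le (star a - a) a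
    rw [h1, zero_mul] at h6
    rw [h2]
    linarith
  rw [h3] at h5
  by_contra hlt
  push Not at hlt
  nlinarith

/-- `C(Qut_c(X))`: the universal `C*`-algebra of the colored graph `(X, c)`. -/
abbrev QutAlgebra (X : SimpleGraph V) (c : V → C) : Type u :=
  UniversalCStar (qutRelators X c) (isBoundedRel_qutRel X c)

variable (X : SimpleGraph V) (c : V → C)

/-- The fundamental representation of `Qut_c(X)`. -/
def qutU (i j : V) : QutAlgebra X c := UniversalCStar.gen _ _ (i, j)

theorem isQutFamily_qutU : IsQutFamily X c (qutU X c) := by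
  have h (r) (hr : QutRel X c r) :
      UniversalCStar.mk _ (isBoundedRel_qutRel X c) r = 0 := UniversalCStar.mk_rel hr
  exact
    { star_eq := fun i j => by simpa [map_star, sub_eq_zero] using! h _ (.star i j)
      idem := fun i j => by simpa [sub_eq_zero] using! h _ (.idem i j)
      row := fun i => by simpa [sub_eq_zero] using! h _ (.row i)
      col := fun j => by simpa [sub_eq_zero] using! h _ (.col j)
      adj := fun i j k l hh => by simpa using! h _ (.adj i j k l hh)
      color := fun i j hh => by simpa using! h _ (.color i j hh) }

variable {X c}

/-- The universal property of `C(Qut_c(X))`. -/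
def qutLift {B : Type*} [CStarAlgebra B] (v : V → V → B) (hv : IsQutFamily X c v) :
    QutAlgebra X c →⋆ₐ[ℂ] B :=
  UniversalCStar.lift (fun ij => v ij.1 ij.2) ((lift_qutRel_iff _).mpr hv)

theorem qutLift_qutU {B : Type*} [CStarAlgebra B] (v : V → V → B) (hv : IsQutFamily X c v)
    (i j : V) : qutLift v hv (qutU X c i j) = v i j :=
  UniversalCStar.lift_gen ..

/-- Projections in a `C*`-algebra with sum `1` are mutually orthogonal. -/
theorem proj_orthogonal {B : Type*} [CStarAlgebra B] (e : V → B) (hs : ∀ i, star (e i) = e i)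
    (hi : ∀ i, e i * e i = e i) (h1 : ∑ i, e i = 1) {i j : V} (hij : i ≠ j) :
    e i * e j = 0 := by
  classical
  let _ : PartialOrder B := CStarAlgebra.spectralOrder B
  have _ : StarOrderedRing B := CStarAlgebra.spectralOrderedRing B
  have h2 : ∑ k ∈ Finset.univ.erase j, star (e k * e j) * (e k * e j) = 0 := by
    have h3 (k : V) : star (e k * e j) * (e k * e j) = e j * e k * e j := by
      rw [star_mul, hs, hs, mul_assoc, ← mul_assoc (e k), hi, mul_assoc]
    have h4 : ∑ k, star (e k * e j) * (e k * e j) = e j := by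
      simp_rw [h3, ← Finset.sum_mul, ← Finset.mul_sum, h1, mul_one, hi]
    rw [← Finset.add_sum_erase _ _ (Finset.mem_univ j), h3, hi, hi] at h4
    exact add_eq_left.mp h4
  have h5 := (Finset.sum_eq_zero_iff_of_nonneg (fun k _ => star_mul_self_nonneg _)).mp h2 i
    (Finset.mem_erase.mpr ⟨hij, Finset.mem_univ i⟩)
  exact CStarRing.star_mul_self_eq_zero_iff _ |>.mp h5

namespace IsQutFamily

variable {B : Type*} [CStarAlgebra B] {v : V → V → B}

theorem row_orth (hv : IsQutFamily X c v) (i : V) {j k : V} (h : j ≠ k) :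
    v i j * v i k = 0 :=
  proj_orthogonal (v i) (hv.star_eq i) (hv.idem i) (hv.row i) h

theorem col_orth (hv : IsQutFamily X c v) (j : V) {i k : V} (h : i ≠ k) :
    v i j * v k j = 0 :=
  proj_orthogonal (fun i => v i j) (fun i => hv.star_eq i j) (fun i => hv.idem i j) (hv.col j) h

theorem isUnit [DecidableEq V] (hv : IsQutFamily X c v) : IsUnit (Matrix.of v) := by
  refine ⟨⟨Matrix.of v, (Matrix.of v).transpose, ?_, ?_⟩, rfl⟩
  · ext i j
    rw [Matrix.mul_apply]
    simp only [Matrix.of_apply, Matrix.transpose_apply]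
    rcases eq_or_ne i j with rfl | h
    · simp [hv.idem, hv.row]
    · rw [Matrix.one_apply_ne h]
      exact Finset.sum_eq_zero fun k _ => hv.col_orth k h
  · ext i j
    rw [Matrix.mul_apply]
    simp only [Matrix.of_apply, Matrix.transpose_apply]
    rcases eq_or_ne i j with rfl | h
    · simp [hv.idem, hv.col]
    · rw [Matrix.one_apply_ne h]
      exact Finset.sum_eq_zero fun k _ => hv.row_orth k h

end IsQutFamily

section minTmul

variable {A : Type u} {B : Type v} [CStarAlgebra A] [CStarAlgebra B]

theorem minTmul_mul (a a' : A) (b b' : B) :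
    minTmul a b * minTmul a' b' = minTmul (a * a') (b * b') := by
  simp only [minTmul, ← map_mul, Algebra.TensorProduct.tmul_mul_tmul]

theorem star_minTmul (a : A) (b : B) : star (minTmul a b) = minTmul (star a) (star b) := by
  simp only [minTmul, ← map_star, TensorProduct.star_tmul]

theorem minTmul_one_one : minTmul (1 : A) (1 : B) = 1 :=
  map_one (spatialNorm A B).toCompl

theorem minTmul_zero_left (b : B) : minTmul (0 : A) b = 0 := by
  simp [minTmul]

theorem minTmul_zero_right (a : A) : minTmul a (0 : B) = 0 := by
  simp [minTmul]

theorem minTmul_sum_left {n : Type*} (s : Finset n) (f : n → A) (b : B) :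
    minTmul (∑ i ∈ s, f i) b = ∑ i ∈ s, minTmul (f i) b := by
  simp [minTmul, TensorProduct.sum_tmul]

theorem minTmul_sum_right {n : Type*} (s : Finset n) (a : A) (f : n → B) :
    minTmul a (∑ i ∈ s, f i) = ∑ i ∈ s, minTmul a (f i) := by
  simp [minTmul, TensorProduct.tmul_sum]

/-- The elementary tensor of two nonzero projections is nonzero. -/
theorem minTmul_ne_zero {p : A} {q : B} (hp : star p = p) (hpp : p * p = p) (p0 : p ≠ 0)
    (hq : star q = q) (hqq : q * q = q) (q0 : q ≠ 0) : minTmul p q ≠ 0 := by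
  obtain ⟨H, _, _, _, π, hπ⟩ := exists_rep_ne_zero p hp hpp p0
  obtain ⟨K, _, _, _, ρ, hρ⟩ := exists_rep_ne_zero q hq hqq q0
  obtain ⟨x, hx⟩ := DFunLike.ne_iff.mp hπ
  obtain ⟨y, hy⟩ := DFunLike.ne_iff.mp hρ
  let π' : HilbertRep A := ⟨H, π⟩
  let ρ' : HilbertRep B := ⟨K, ρ⟩
  intro h
  have h1 : ‖tensorRep π' ρ' (p ⊗ₜ q)‖ ≤ 0 := by
    refine (CStarSeminorm.le_sup (p := CStarSeminorm.ofStarAlgHom (tensorRep π' ρ'))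
      spatial_bdd ⟨π', ρ', rfl⟩ (p ⊗ₜ q)).trans ?_
    exact (((spatialNorm A B).norm_toCompl (p ⊗ₜ q)).symm.trans (norm_eq_zero.mpr h)).le
  have h2 : tensorRep π' ρ' (p ⊗ₜ q) = 0 := norm_le_zero_iff.mp h1
  rw [tensorRep_tmul] at h2
  have h3 := tensorOp_of_tmul (π'.hom p) (ρ'.hom q) x y
  rw [h2] at h3
  have h4 := congrArg norm h3
  rw [LinearIsometry.norm_map, TensorProduct.norm_tmul] at h4
  have h5 : ‖π'.hom p x‖ * ‖ρ'.hom q y‖ = 0 := by rw [← h4]; exact norm_zero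
  rcases mul_eq_zero.mp h5 with h6 | h6
  · exact hx (norm_eq_zero.mp h6)
  · exact hy (norm_eq_zero.mp h6)

end minTmul

/-- The products `∑ k, v i k ⊗ w k j` again satisfy the relations. -/
theorem IsQutFamily.comul {A : Type*} {B : Type*} [CStarAlgebra A] [CStarAlgebra B]
    {v : V → V → A} {w : V → V → B} (hv : IsQutFamily X c v) (hw : IsQutFamily X c w) :
    IsQutFamily X c fun i j => ∑ k, minTmul (v i k) (w k j) where
  star_eq i j := by simp only [star_sum, star_minTmul, hv.star_eq, hw.star_eq]
  idem i j := by
    classical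
    simp only [Finset.sum_mul, Finset.mul_sum, minTmul_mul]
    refine Finset.sum_congr rfl fun k _ => ?_
    rw [Finset.sum_eq_single k]
    · rw [hv.idem, hw.idem]
    · intro l _ hl
      rw [hv.row_orth i hl, minTmul_zero_left]
    · simp
  row i := by
    rw [Finset.sum_comm]
    simp only [← minTmul_sum_right, hw.row, ← minTmul_sum_left, hv.row, minTmul_one_one]
  col j := by
    rw [Finset.sum_comm]
    simp only [← minTmul_sum_left, hv.col, ← minTmul_sum_right, hw.col, minTmul_one_one]
  adj i j k l h := by
    simp only [Finset.sum_mul, Finset.mul_sum, minTmul_mul]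
    refine Finset.sum_eq_zero fun b _ => Finset.sum_eq_zero fun a _ => ?_
    by_cases hab : X.Adj a b
    · rcases h with h | h
      · rw [hw.adj a j b l (Or.inl ⟨hab, h.2⟩), minTmul_zero_right]
      · rw [hv.adj i a k b (Or.inr ⟨h.1, hab⟩), minTmul_zero_left]
    · rcases h with h | h
      · rw [hv.adj i a k b (Or.inl ⟨h.1, hab⟩), minTmul_zero_left]
      · rw [hw.adj a j b l (Or.inr ⟨hab, h.2⟩), minTmul_zero_right]
  color i j h := by
    refine Finset.sum_eq_zero fun k _ => ?_
    by_cases hk : c i = c k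
    · rw [hw.color k j (fun e => h (hk.trans e)), minTmul_zero_right]
    · rw [hv.color i k hk, minTmul_zero_left]

variable (X c)

/-- The comultiplication of `Qut_c(X)`. -/
def qutComul : QutAlgebra X c →⋆ₐ[ℂ] MinTensor (QutAlgebra X c) (QutAlgebra X c) :=
  qutLift _ ((isQutFamily_qutU X c).comul (isQutFamily_qutU X c))

/-- The quantum automorphism group `Qut_c(X)` of the graph `X` with vertex coloring `c`. -/
def Qut [DecidableEq V] : CompactMatrixQuantumGroup.{u} V where
  algebra := QutAlgebra X c
  u := Matrix.of (qutU X c)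
  generates := UniversalCStar.generates
  isUnit_u := (isQutFamily_qutU X c).isUnit
  isUnit_u_star := by
    have h : (Matrix.of (qutU X c)).map star = Matrix.of (qutU X c) := by
      ext i j
      exact (isQutFamily_qutU X c).star_eq i j
    rw [h]
    exact (isQutFamily_qutU X c).isUnit
  comul := qutComul X c
  comul_u i j := qutLift_qutU _ _ i j

theorem qutU_self_ne_zero (i : V) : qutU X c i i ≠ 0 := by
  classical
  have hv : IsQutFamily X c (fun i j : V => if i = j then (1 : ℂ) else 0) :=
    { star_eq := fun i j => by split_ifs <;> simp
      idem := fun i j => by split_ifs <;> simp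
      row := fun i => by simp
      col := fun j => by simp
      adj := fun i j k l h => by
        by_cases h1 : i = j <;> by_cases h2 : k = l
        · subst h1 h2; tauto
        all_goals simp [h1, h2]
      color := fun i j h => by
        rw [if_neg]
        rintro rfl
        exact h rfl }
  intro h
  have := qutLift_qutU _ hv i i
  rw [h, map_zero] at this
  simp at this

theorem qutU_symm {i j : V} (h : qutU X c i j ≠ 0) : qutU X c j i ≠ 0 := by
  have hu := isQutFamily_qutU X c
  have hv : IsQutFamily X c (fun i j : V => MulOpposite.op (qutU X c j i)) :=
    { star_eq := fun i j => by rw [← MulOpposite.op_star, hu.star_eq]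
      idem := fun i j => by rw [← MulOpposite.op_mul, hu.idem]
      row := fun i => by rw [← Finset.op_sum, hu.col, MulOpposite.op_one]
      col := fun j => by rw [← Finset.op_sum, hu.row, MulOpposite.op_one]
      adj := fun i j k l h => by
        rw [← MulOpposite.op_mul, hu.adj l k j i, MulOpposite.op_zero]
        rw [X.adj_comm l j, X.adj_comm k i]
        tauto
      color := fun i j h => by rw [hu.color j i (Ne.symm h), MulOpposite.op_zero] }
  intro h0
  have h1 := qutLift_qutU _ hv j i
  rw [h0, map_zero] at h1
  exact h (MulOpposite.op_injective h1.symm)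

theorem qutU_trans {i j k : V} (hij : qutU X c i j ≠ 0) (hjk : qutU X c j k ≠ 0) :
    qutU X c i k ≠ 0 := by
  have hu := isQutFamily_qutU X c
  intro h
  have h1 : ∑ l, minTmul (qutU X c i l) (qutU X c l k) = 0 := by
    rw [← qutLift_qutU _ (hu.comul hu) i k, h, map_zero]
  have h2 : minTmul (qutU X c i j) 1 * ∑ l, minTmul (qutU X c i l) (qutU X c l k) =
      minTmul (qutU X c i j) (qutU X c j k) := by
    classical
    simp only [Finset.mul_sum, minTmul_mul, one_mul]
    rw [Finset.sum_eq_single j]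
    · rw [hu.idem]
    · intro l _ hl
      rw [hu.row_orth i hl.symm, minTmul_zero_left]
    · simp
  rw [h1, mul_zero] at h2
  exact minTmul_ne_zero (hu.star_eq i j) (hu.idem i j) hij (hu.star_eq j k) (hu.idem j k) hjk
    h2.symm

/-- The equivalence relation `i ∼ j ↔ u i j ≠ 0`, whose classes are the quantum orbits. -/
def quantumOrbitSetoid : Setoid V where
  r i j := qutU X c i j ≠ 0
  iseqv := ⟨qutU_self_ne_zero X c, qutU_symm X c, qutU_trans X c⟩

/-- `S` is a union of quantum orbits of `(X, c)`, that is, of orbits of `Qut_c(X)`. -/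
def IsUnionOfQuantumOrbits (S : Set V) : Prop :=
  ∃ O ⊆ (quantumOrbitSetoid X c).classes, S = ⋃₀ O

end Qut

/-! ### Modifications of colored graphs -/

section Modifications

variable {V : Type u} {C : Type v}

/-- `S` is a union of color classes of the coloring `c`. -/
def IsUnionOfColorClasses (c : V → C) (S : Set V) : Prop := ∃ K : Set C, S = c ⁻¹' K

/-- `S` is monochromatic for the coloring `c`. -/
def IsMonochromatic (c : V → C) (S : Set V) : Prop := ∀ v ∈ S, ∀ w ∈ S, c v = c w

/-- Add all edges between distinct vertices of `S`. -/
def completeOn (X : SimpleGraph V) (S : Set V) : SimpleGraph V :=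
  X ⊔ SimpleGraph.fromRel fun v w => v ∈ S ∧ w ∈ S

/-- Add all edges between a vertex of `S` and a vertex of `T`. -/
def joinBetween (X : SimpleGraph V) (S T : Set V) : SimpleGraph V :=
  X ⊔ SimpleGraph.fromRel fun v w => v ∈ S ∧ w ∈ T

open Classical in
/-- Give all vertices of `S` the color `a`. -/
def recolor (c : V → C) (S : Set V) (a : C) : V → C := fun v => if v ∈ S then a else c v

/-- Add one isolated vertex (the vertex `none`). -/
def addIsolated (X : SimpleGraph V) : SimpleGraph (Option V) := X.map Function.Embedding.some

/-- Extend a coloring by giving the added vertex the color `a`. -/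
def extendColoring (c : V → C) (a : C) : Option V → C := fun v => v.elim a c

end Modifications

end

/-! By the universal property, a `*`-homomorphism out of `QutAlgebra X c` is the same thing as a
family of elements satisfying `IsQutFamily X c`, and it is determined by that family
(`qutAlgebra_hom_ext`). So an isomorphism of quantum groups amounts to a pair of families, each in
the algebra of the other graph, that are mutually inverse and respect `Δ` on generators
(`Qut.isomorphic_of_families`).

In the first three modifications the vertex set does not change and both maps are `u i j ↦ u i j`.
Inverseness and compatibility with `Δ` are then automatic, and only the equivalence of the two sets
of relations remains.

For added edges the key is `IsQutFamily.of_adj_iff`. A product `u i j * u k l` already vanishes when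
a factor does, or when exactly one of `i = k`, `j = l` holds, because the entries in a row or column
are mutually orthogonal. So an adjacency relation has content only for nonzero entries with `i ≠ k`
and `j ≠ l`. A nonzero entry preserves color, hence membership in `S` and `T`, so the edge is added
at `(i, k)` exactly when it is added at `(j, l)`. Where it is added, independence makes both pairs
non-adjacent before and adjacent afterwards; elsewhere nothing changes. Hence the adjacency
constraints coincide.

For recoloring, the new color relations hold because a nonzero `u i j` puts `i` and `j` in the same
quantum orbit. Conversely, since `S` is monochromatic and the new color does not occur outside it,
the new coloring separates all vertices that the old one did.

An isolated vertex with a color of its own forces the fundamental matrix to be block diagonal with a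
block `1`. Deleting that block and putting it back are inverse operations. -/

/-! ### Isomorphisms from the universal property -/

/-- Two `*`-homomorphisms on `C(Qut_c(X))` agree if they agree on the fundamental representation. -/
theorem qutAlgebra_hom_ext {V : Type*} [Fintype V] {C : Type*} {X : SimpleGraph V} {c : V → C}
    {B : Type*} [CStarAlgebra B] {φ ψ : QutAlgebra X c →⋆ₐ[ℂ] B}
    (h : ∀ i j, φ (qutU X c i j) = ψ (qutU X c i j)) : φ = ψ := by
  -- `*`-homomorphisms between `C*`-algebras are continuous and the image of the free `*`-algebra is
  -- dense, so it is enough to compare there; the letters generate that algebra.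
  refine CStarSeminorm.hom_ext (universalSeminorm (qutRelators X c) (isBoundedRel_qutRel X c))
    fun x => ?_
  have e : φ.comp (UniversalCStar.mk (qutRelators X c) (isBoundedRel_qutRel X c)) =
      ψ.comp (UniversalCStar.mk (qutRelators X c) (isBoundedRel_qutRel X c)) := by
    refine StarAlgHom.ext_of_adjoin_eq_top FreeStarAlgebra.adjoin_ι ?_
    rintro _ ⟨⟨i, j⟩, rfl⟩
    exact h i j
  exact DFunLike.congr_fun e x

/-- Mutually inverse families that satisfy the relations of two colored graphs define an
isomorphism of their quantum automorphism groups, provided one of them is compatible with the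
comultiplications. -/
theorem Qut.isomorphic_of_families {V W : Type u} [Fintype V] [DecidableEq V] [Fintype W]
    [DecidableEq W] {C : Type*} {D : Type*} {X : SimpleGraph V} {c : V → C} {Y : SimpleGraph W}
    {d : W → D} (v : V → V → QutAlgebra Y d) (hv : IsQutFamily X c v)
    (w : W → W → QutAlgebra X c) (hw : IsQutFamily Y d w)
    (hwv : ∀ i j, qutLift w hw (v i j) = qutU X c i j)
    (hvw : ∀ i j, qutLift v hv (w i j) = qutU Y d i j)
    (hΔ : ∀ i j, qutComul Y d (v i j) = ∑ k, minTmul (v i k) (v k j)) :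
    (Qut X c).Isomorphic (Qut Y d) := by
  have e₁ : (qutLift w hw).comp (qutLift v hv) = StarAlgHom.id ℂ _ :=
    qutAlgebra_hom_ext fun i j => by
      rw [StarAlgHom.comp_apply, qutLift_qutU, hwv]; rfl
  have e₂ : (qutLift v hv).comp (qutLift w hw) = StarAlgHom.id ℂ _ :=
    qutAlgebra_hom_ext fun i j => by
      rw [StarAlgHom.comp_apply, qutLift_qutU, hvw]; rfl
  -- Both sides are `*`-homomorphisms on `QutAlgebra X c`, so the identity for all elements reduces
  -- to the generators, where `hΔ` is exactly what is needed.
  have e₃ : (minTensorMap (qutLift v hv) (qutLift v hv)).comp (qutComul X c) =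
      (qutComul Y d).comp (qutLift v hv) := qutAlgebra_hom_ext fun i j => by
    have h : qutComul X c (qutU X c i j) = ∑ k, minTmul (qutU X c i k) (qutU X c k j) :=
      qutLift_qutU _ _ i j
    rw [StarAlgHom.comp_apply, StarAlgHom.comp_apply, qutLift_qutU, hΔ, h, map_sum]
    simp only [minTensorMap_tmul, qutLift_qutU]
  exact ⟨StarAlgEquiv.ofStarAlgHom (qutLift v hv) (qutLift w hw) e₁ e₂,
    fun a => DFunLike.congr_fun e₃ a⟩

/-- If the relations of two colored graphs on the same vertex set are equivalent, then the quantum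
automorphism groups are isomorphic. -/
theorem Qut.isomorphic_of_isQutFamily {V : Type u} [Fintype V] [DecidableEq V] {C : Type*}
    {D : Type*} {X Y : SimpleGraph V} {c : V → C} {d : V → D}
    (hX : IsQutFamily X c (qutU Y d)) (hY : IsQutFamily Y d (qutU X c)) :
    (Qut X c).Isomorphic (Qut Y d) :=
  -- Each map sends `u i j` to `u i j`, and the formula for `Δ` on generators involves neither the
  -- edges nor the coloring.
  Qut.isomorphic_of_families _ hX _ hY (fun _ _ => qutLift_qutU ..) (fun _ _ => qutLift_qutU ..)
    (fun _ _ => qutLift_qutU ..)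

/-! ### Adding edges within and between unions of color classes -/

/-- A union of color classes is invariant under any family that preserves the coloring. -/
theorem IsQutFamily.mem_iff_of_ne_zero {V : Type*} [Fintype V] {C : Type*} {X : SimpleGraph V}
    {c : V → C} {B : Type*} [Ring B] [StarRing B] {v : V → V → B} (hv : IsQutFamily X c v)
    {S : Set V} (hS : IsUnionOfColorClasses c S) {i j : V} (h : v i j ≠ 0) : i ∈ S ↔ j ∈ S := by
  obtain ⟨K, rfl⟩ := hS
  have hc : c i = c j := by
    by_contra hc
    exact h (hv.color i j hc)
  simp only [Set.mem_preimage, hc]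

/-- To pass between graphs with the same coloring, it suffices to compare adjacency on pairs that
the family relates, and that are distinct on both sides. -/
theorem IsQutFamily.of_adj_iff {V : Type*} [Fintype V] {C : Type*} {X Y : SimpleGraph V}
    {c : V → C} {B : Type*} [CStarAlgebra B] {v : V → V → B} (hv : IsQutFamily X c v)
    (h : ∀ i j k l, v i j ≠ 0 → v k l ≠ 0 → i ≠ k → j ≠ l → (X.Adj i k ↔ X.Adj j l) →
      (Y.Adj i k ↔ Y.Adj j l)) : IsQutFamily Y c v where
  star_eq := hv.star_eq
  idem := hv.idem
  row := hv.row
  col := hv.col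
  color := hv.color
  adj i j k l hY := by
    by_contra h0
    have hij : v i j ≠ 0 := fun e => h0 (by rw [e, zero_mul])
    have hkl : v k l ≠ 0 := fun e => h0 (by rw [e, mul_zero])
    -- A nonzero product cannot be one that the adjacency relations of `X` kill.
    have hX : X.Adj i k ↔ X.Adj j l := by
      have := mt (hv.adj i j k l) h0
      tauto
    -- If `i = k`, there is no loop at `i`, so the mismatch in `Y` must be an edge between `j` and
    -- `l`. Then the factors are distinct entries of one row and their product vanishes. The case `j
    -- = l` is the same with columns.
    have hik : i ≠ k := by
      rintro rfl
      rcases hY with hY | hY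
      · exact hY.1.ne rfl
      · exact h0 (hv.row_orth i hY.2.ne)
    have hjl : j ≠ l := by
      rintro rfl
      rcases hY with hY | hY
      · exact h0 (hv.col_orth j hY.1.ne)
      · exact hY.2.ne rfl
    have := h i j k l hij hkl hik hjl hX
    tauto

/-- Completing an independent union of color classes to a clique does not change `Qut_c(X)`. -/
theorem Qut.isomorphic_completeOn {V : Type u} [Fintype V] [DecidableEq V] {C : Type*}
    {X : SimpleGraph V} {c : V → C} {S : Set V} (hS : X.IsIndepSet S)
    (hc : IsUnionOfColorClasses c S) : (Qut X c).Isomorphic (Qut (completeOn X S) c) := by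
  -- Off the diagonal the inequality built into `fromRel` is automatic, which is why `of_adj_iff`
  -- supplies distinctness on both sides.
  have hY (i k : V) (hik : i ≠ k) : (completeOn X S).Adj i k ↔ X.Adj i k ∨ (i ∈ S ∧ k ∈ S) := by
    simp only [completeOn, SimpleGraph.sup_adj, SimpleGraph.fromRel_adj]
    tauto
  have hX (i k : V) (hik : i ≠ k) (hi : i ∈ S) (hk : k ∈ S) : ¬ X.Adj i k := hS hi hk hik
  refine Qut.isomorphic_of_isQutFamily
    ((isQutFamily_qutU _ c).of_adj_iff fun i j k l hij hkl hik hjl => ?_)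
    ((isQutFamily_qutU _ c).of_adj_iff fun i j k l hij hkl hik hjl => ?_)
  -- Both directions are the same propositional argument: `i` and `k` both lie in `S` iff `j` and
  -- `l` do. In that case `X` has neither edge and the completed graph has both; otherwise the two
  -- graphs agree on both pairs.
  all_goals
    have h₁ := (isQutFamily_qutU _ c).mem_iff_of_ne_zero hc hij
    have h₂ := (isQutFamily_qutU _ c).mem_iff_of_ne_zero hc hkl
    have := hX i k hik
    have := hX j l hjl
    rw [hY i k hik, hY j l hjl]
    tauto

/-- Joining two disjoint unions of color classes with independent union does not change
`Qut_c(X)`. -/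
theorem Qut.isomorphic_joinBetween {V : Type u} [Fintype V] [DecidableEq V] {C : Type*}
    {X : SimpleGraph V} {c : V → C} {S T : Set V} (hST : X.IsIndepSet (S ∪ T))
    (hS : IsUnionOfColorClasses c S) (hT : IsUnionOfColorClasses c T) :
    (Qut X c).Isomorphic (Qut (joinBetween X S T) c) := by
  -- `fromRel` symmetrizes the relation, hence the two disjuncts for an added edge.
  have hY (i k : V) (hik : i ≠ k) : (joinBetween X S T).Adj i k ↔
      X.Adj i k ∨ (i ∈ S ∧ k ∈ T) ∨ (k ∈ S ∧ i ∈ T) := by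
    simp only [joinBetween, SimpleGraph.sup_adj, SimpleGraph.fromRel_adj]
    tauto
  have hX (i k : V) (hik : i ≠ k) (h : (i ∈ S ∧ k ∈ T) ∨ (k ∈ S ∧ i ∈ T)) : ¬ X.Adj i k := by
    rcases h with h | h
    · exact hST (Or.inl h.1) (Or.inr h.2) hik
    · exact hST (Or.inr h.2) (Or.inl h.1) hik
  refine Qut.isomorphic_of_isQutFamily
    ((isQutFamily_qutU _ c).of_adj_iff fun i j k l hij hkl hik hjl => ?_)
    ((isQutFamily_qutU _ c).of_adj_iff fun i j k l hij hkl hik hjl => ?_)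
  all_goals
    have h₁ := (isQutFamily_qutU _ c).mem_iff_of_ne_zero hS hij
    have h₂ := (isQutFamily_qutU _ c).mem_iff_of_ne_zero hS hkl
    have h₃ := (isQutFamily_qutU _ c).mem_iff_of_ne_zero hT hij
    have h₄ := (isQutFamily_qutU _ c).mem_iff_of_ne_zero hT hkl
    -- The condition for being a newly joined pair is transported from `(i, k)` to `(j, l)`, so one
    -- case distinction serves both pairs.
    have hP : (i ∈ S ∧ k ∈ T) ∨ (k ∈ S ∧ i ∈ T) ↔ (j ∈ S ∧ l ∈ T) ∨ (l ∈ S ∧ j ∈ T) := by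
      rw [h₁, h₂, h₃, h₄]
    have a₁ := hX i k hik
    have a₂ := hX j l hjl
    rw [hY i k hik, hY j l hjl]
    rw [hP] at a₁ ⊢
    -- For a newly joined pair, both adjacencies are false in `X` and true in the join, so both
    -- equivalences hold trivially. Otherwise they are literally the same statement.
    by_cases hp : (j ∈ S ∧ l ∈ T) ∨ (l ∈ S ∧ j ∈ T)
    · simp only [hp, a₁ hp, a₂ hp, or_true, implies_true]
    · simp only [hp, or_false, imp_self]

/-! ### Recoloring a union of quantum orbits -/

/-- The color relations may be exchanged for any others that the family satisfies. -/
theorem IsQutFamily.of_color {V : Type*} [Fintype V] {C : Type*} {D : Type*} {X : SimpleGraph V}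
    {c : V → C} {d : V → D} {B : Type*} [Ring B] [StarRing B] {v : V → V → B}
    (hv : IsQutFamily X c v) (h : ∀ i j, d i ≠ d j → v i j = 0) : IsQutFamily X d v where
  star_eq := hv.star_eq
  idem := hv.idem
  row := hv.row
  col := hv.col
  adj := hv.adj
  color := h

/-- A union of quantum orbits is invariant under the fundamental representation. -/
theorem IsUnionOfQuantumOrbits.mem_iff_of_qutU_ne_zero {V : Type*} [Fintype V] {C : Type*}
    {X : SimpleGraph V} {c : V → C} {S : Set V} (hS : IsUnionOfQuantumOrbits X c S) {i j : V}
    (h : qutU X c i j ≠ 0) : i ∈ S ↔ j ∈ S := by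
  obtain ⟨O, hO, rfl⟩ := hS
  simp only [Set.mem_sUnion]
  refine exists_congr fun s => and_congr_right fun hs => ?_
  -- Each member of `O` is the set of vertices related to some `y`. Hence the claim is symmetry and
  -- transitivity of `u i j ≠ 0`, the latter resting on the comultiplication and on
  -- `minTmul_ne_zero`.
  obtain ⟨y, rfl⟩ := hO hs
  exact ⟨fun hi => (quantumOrbitSetoid X c).trans' (qutU_symm X c h) hi,
    fun hj => (quantumOrbitSetoid X c).trans' h hj⟩

/-- Giving a new color to a monochromatic union of quantum orbits does not change `Qut_c(X)`. -/
theorem Qut.isomorphic_recolor {V : Type u} [Fintype V] [DecidableEq V] {C : Type*} {D : Type*}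
    {X : SimpleGraph V} {c : V → C} (f : C ↪ D) {S : Set V} {a : D} (hS : IsMonochromatic c S)
    (hO : IsUnionOfQuantumOrbits X c S) (ha : ∀ v ∉ S, f (c v) ≠ a) :
    (Qut X c).Isomorphic (Qut X (recolor (f ∘ c) S a)) := by
  refine Qut.isomorphic_of_isQutFamily
    ((isQutFamily_qutU _ _).of_color fun i j hij => (isQutFamily_qutU _ _).color i j ?_)
    ((isQutFamily_qutU _ _).of_color fun i j hij => ?_)
  -- Vertices with different old colors keep different colors: they cannot both lie in `S`,
  -- freshness of `a` separates `S` from its complement, and outside `S` injectivity of `f` applies.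
  · by_cases hi : i ∈ S <;> by_cases hj : j ∈ S <;> simp only [recolor, hi, hj, if_true, if_false]
    · exact absurd (hS i hi j hj) hij
    · exact (ha j hj).symm
    · exact ha i hi
    · exact f.injective.ne hij
  -- A nonzero entry of the original matrix links vertices of one quantum orbit and one old color.
  -- Thus both get `a` or both keep the same old color.
  · by_contra h
    have hm := hO.mem_iff_of_qutU_ne_zero h
    have hc : c i = c j := by
      by_contra hc
      exact h ((isQutFamily_qutU _ _).color i j hc)
    exact hij (by by_cases hj : j ∈ S <;> simp [recolor, hm, hj, hc])

/-! ### Adding an isolated vertex -/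

theorem addIsolated_adj_some {V : Type*} {X : SimpleGraph V} {i k : V} :
    (addIsolated X).Adj (some i) (some k) ↔ X.Adj i k :=
  SimpleGraph.map_adj_apply (f := Function.Embedding.some)

theorem not_addIsolated_adj_none {V : Type*} {X : SimpleGraph V} {k : Option V} :
    ¬ (addIsolated X).Adj none k := by
  rintro ⟨-, _, _, -, h, -⟩
  exact Option.some_ne_none _ h

/-- The family on `Option V` that extends `v` by a fixed point. -/
def optionFamily {V B : Type*} [Zero B] [One B] (v : V → V → B) : Option V → Option V → B
  | none, none => 1
  | some i, some j => v i j
  | _, _ => 0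

/-- A family for `X`, extended by a fixed point, is a family for `X` with an isolated vertex. -/
theorem IsQutFamily.option {V : Type*} [Fintype V] {C : Type*} {D : Type*} {X : SimpleGraph V}
    {c : V → C} {d : Option V → D} {B : Type*} [Ring B] [StarRing B] {v : V → V → B}
    (hv : IsQutFamily X c v) (hd : ∀ i j, d (some i) ≠ d (some j) → c i ≠ c j) :
    IsQutFamily (addIsolated X) d (optionFamily v) where
  star_eq
    | none, none => star_one _
    | none, some _ => star_zero _
    | some _, none => star_zero _
    | some i, some j => hv.star_eq i j
  idem
    | none, none => one_mul _
    | none, some _ => zero_mul _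
    | some _, none => zero_mul _
    | some i, some j => hv.idem i j
  row
    | none => by simp [Fintype.sum_option, optionFamily]
    | some i => by simp [Fintype.sum_option, optionFamily, hv.row]
  col
    | none => by simp [Fintype.sum_option, optionFamily]
    | some i => by simp [Fintype.sum_option, optionFamily, hv.col]
  adj i j k l h := by
    rcases i with _ | i <;> rcases j with _ | j <;> rcases k with _ | k <;> rcases l with _ | l
    case some.some.some.some => exact hv.adj i j k l (by simpa only [addIsolated_adj_some] using h)
    -- If an index pair mixes old and new vertices, its entry is zero. In the remaining cases `none`
    -- occurs in both adjacency conditions, so both fail and there is no mismatch to treat.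
    all_goals first
      | exact zero_mul _
      | exact mul_zero _
      | exact absurd h (by simp [not_addIsolated_adj_none, SimpleGraph.adj_comm _ _ none])
  color
    | none, none => fun h => absurd rfl h
    | none, some _ => fun _ => rfl
    | some _, none => fun _ => rfl
    | some i, some j => fun h => hv.color i j (hd i j h)

/-- Adding an isolated vertex in a new color does not change `Qut_c(X)`. -/
theorem Qut.isomorphic_addIsolated {V : Type u} [Fintype V] [DecidableEq V] {C : Type*}
    {D : Type*} {X : SimpleGraph V} {c : V → C} (f : C ↪ D) {a : D} (ha : ∀ v, f (c v) ≠ a) :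
    (Qut X c).Isomorphic (Qut (addIsolated X) (extendColoring (f ∘ c) a)) := by
  set Y := addIsolated X
  set d := extendColoring (f ∘ c) a
  have hu := isQutFamily_qutU Y d
  have h₁ (i : V) : qutU Y d (some i) none = 0 := hu.color _ _ (ha i)
  have h₂ (i : V) : qutU Y d none (some i) = 0 := hu.color _ _ (ha i).symm
  -- Only the diagonal entry survives in the row of the new vertex, and the row sums to `1`.
  have h₀ : qutU Y d none none = 1 := by
    simpa [Fintype.sum_option, h₂] using hu.row none
  -- The old block still has row and column sums `1`, because the entries deleted from its rows and
  -- columns vanish.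
  have hv : IsQutFamily X c fun i j => qutU Y d (some i) (some j) :=
    { star_eq := fun i j => hu.star_eq _ _
      idem := fun i j => hu.idem _ _
      row := fun i => by simpa [Fintype.sum_option, h₁] using hu.row (some i)
      col := fun i => by simpa [Fintype.sum_option, h₂] using hu.col (some i)
      adj := fun i j k l h => hu.adj _ _ _ _ (by simpa only [Y, addIsolated_adj_some] using h)
      color := fun i j h => hu.color _ _ (f.injective.ne h) }
  have hw : IsQutFamily Y d (optionFamily (qutU X c)) :=
    (isQutFamily_qutU X c).option fun i j h e => h (congrArg f e)
  refine Qut.isomorphic_of_families _ hv _ hw (fun i j => qutLift_qutU _ hw _ _) ?_ fun i j => ?_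
  -- Extending and then restricting is the identity by definition. In this order the forced values
  -- of the entries at the new vertex are needed.
  · rintro (_ | i) (_ | j)
    · exact (map_one _).trans h₀.symm
    · exact (map_zero _).trans (h₂ j).symm
    · exact (map_zero _).trans (h₁ i).symm
    · exact qutLift_qutU _ hv i j
  -- The sum for `Δ` over the larger vertex set has one extra term, through `none`; its left factor
  -- is zero.
  · refine (qutLift_qutU _ _ (some i) (some j)).trans ?_
    rw [Fintype.sum_option, h₁, minTmul_zero_left, zero_add]

/-- The embedding `f` models an enlargement of the color set. In the recoloring, `a` need only be
absent outside `S`, so the existing color of `S` is allowed when no other vertex has it. -/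
theorem mainTheorem5 {V : Type*} [Fintype V] [DecidableEq V] {C : Type*} (X : SimpleGraph V)
    (c : V → C) :
    -- completing an independent union of color classes to a clique
    (∀ S : Set V, X.IsIndepSet S → IsUnionOfColorClasses c S →
      (Qut X c).Isomorphic (Qut (completeOn X S) c)) ∧
    -- joining two disjoint unions of color classes
    (∀ S T : Set V, Disjoint S T → X.IsIndepSet (S ∪ T) → IsUnionOfColorClasses c S →
      IsUnionOfColorClasses c T → (Qut X c).Isomorphic (Qut (joinBetween X S T) c)) ∧
    -- recoloring a monochromatic union of quantum orbits
    (∀ (D : Type*) (f : C ↪ D) (S : Set V) (a : D), IsMonochromatic c S →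
      IsUnionOfQuantumOrbits X c S → (∀ v ∉ S, f (c v) ≠ a) →
      (Qut X c).Isomorphic (Qut X (recolor (f ∘ c) S a))) ∧
    -- adding an isolated vertex of a new color
    (∀ (D : Type*) (f : C ↪ D) (a : D), (∀ v, f (c v) ≠ a) →
      (Qut X c).Isomorphic (Qut (addIsolated X) (extendColoring (f ∘ c) a))) :=
  ⟨fun _ hS hc => Qut.isomorphic_completeOn hS hc,
    fun _ _ _ hST hS hT => Qut.isomorphic_joinBetween hST hS hT,
    fun _ f _ _ hS hO ha => Qut.isomorphic_recolor f hS hO ha,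
    fun _ f _ ha => Qut.isomorphic_addIsolated f ha⟩
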